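/- Let $d\ge 1$, $d<p<\infty$, and $\mathbb T^d=\mathbb R^d/\mathbb Z^d$ with its Lebesgue measure and geodesic distance $|x-y|$. Let $T>0$ and let $b\in[L^1(0,T;W^{1,p}(\mathbb T^d))\cap L^\infty((0,T)\times\mathbb T^d)]^d$ with $(\operatorname{div} b)^-\in L^1(0,T;L^\infty(\mathbb T^d))$. Let $\Phi$ be a regular Lagrangian flow of $b$ on $[0,T]$ with compressibility constant $L$: for a.e. $x$ the curve $t\mapsto\Phi(t,x)$ is an absolutely continuous solution of $\partial_t\Phi(t,x)=b(t,\Phi(t,x))$, $\Phi(0,x)=x$, and $\Phi(t,\cdot)_\#\mathscr L^d\le L\,\mathscr L^d$ for every $t\in[0,T]$. Let $\{Q_i\}_{i=1}^N$ be a partition of $\mathbb T^d$ into measurable cells with $\operatorname{diam}(Q_i)\le\Delta x$ for all $i$, where $\Delta x>0$; fix points $x_0^i\in Q_i$; let $\Delta t>0$ with $M\Delta t=T$ for some $M\in\mathbb N$, and put $t_n=n\Delta t$. The cell-averaged Euler approximation $\bar\Phi_E$ is defined by $\bar\Phi_E(0,x)=x$ and, for $x\in Q_i$ and $t\in[t_n,t_{n+1}]$,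 $$\bar\Phi_E(t,x)=\bar\Phi_E(t_n,x)+(t-t_n)\,\frac1{\Delta t}\int_{t_n}^{t_{n+1}}\frac1{|Q_i|}\int_{Q_i} b\big(s,\bar\Phi_E(t_n,x_0^i)+y-x_0^i\big)\,dy\,ds$$ (the choice of the average on cells of measure zero is immaterial). Then, if $\max\{\Delta t,\Delta x\}<1$, for every $t\in[0,T]$ $$\|\Phi(t,\cdot)-\bar\Phi_E(t,\cdot)\|_{L^p(\mathbb T^d)}\le C_t\,\big|\log(\max\{\Delta t,\Delta x\})\big|^{-1},$$ where $C_t\to0$ as $t\to0^+$ and $C_t$ depends only on $t$, $d$, $p$, $L$ and on upper bounds for $\|b\|_{L^\infty((0,T)\times\mathbb T^d)}$ and $\|D_xb\|_{L^1(0,T;L^p(\mathbb T^d))}$; in particular $C_t$ does not depend on $\Delta t$, $\Delta x$, the partition or the points $x_0^i$. -/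

import Mathlib

open MeasureTheory Set Filter Topology
open scoped ENNReal NNReal ContDiff

noncomputable section

/-- Vectors of `ℝᵈ`, with the Euclidean norm. -/
abbrev Vec (d : ℕ) : Type := EuclideanSpace ℝ (Fin d)

/-- The torus `𝕋ᵈ = ℝᵈ / ℤᵈ`; its `volume` is the Lebesgue measure, of total mass one. -/
abbrev Torus (d : ℕ) : Type := UnitAddTorus (Fin d)

/-- The quotient map `ℝᵈ → 𝕋ᵈ`. -/
def toTorus {d : ℕ} (v : Vec d) : Torus d := fun i => ((v i : ℝ) : UnitAddCircle)

/-- The Euclidean length of `z ∈ 𝕋ᵈ`, i.e. the distance from `0` to the class `z` in `ℝᵈ`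
(the norm on the unit circle is the distance to the nearest integer). The geodesic distance
`|x - y|` of two points of the torus is `torusNorm (x - y)`. -/
def torusNorm {d : ℕ} (z : Torus d) : ℝ := √(∑ i, ‖z i‖ ^ 2)

/-- The measure `dt ⊗ dx` on `(0,T) × 𝕋ᵈ`. -/
def spaceTime (d : ℕ) (T : ℝ) : Measure (ℝ × Torus d) :=
  (volume.restrict (Ioc 0 T)).prod volume

/-- `g` is the weak (distributional) differential of the vector field `f` on `𝕋ᵈ`: for every
smooth `φ : 𝕋ᵈ → ℝ` and every direction `v`, `∫ (∂ᵥφ) f = - ∫ φ (g v)`. -/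
def HasWeakGradient {d : ℕ} (f : Torus d → Vec d) (g : Torus d → Vec d →L[ℝ] Vec d) : Prop :=
  ∀ φ : Torus d → ℝ, ContDiff ℝ ∞ (fun w : Vec d => φ (toTorus w)) → ∀ v : Vec d,
    ∫ x, deriv (fun s : ℝ => φ (x + toTorus (s • v))) 0 • f x = - ∫ x, φ x • g x v

/-- The negative part of the trace of a matrix field; applied to the weak gradient of `b(t, ·)`
this is `(div b(t, ·))⁻`. -/
def negDiv {d : ℕ} (g : Torus d → Vec d →L[ℝ] Vec d) (x : Torus d) : ℝ :=
  max (-(LinearMap.trace ℝ (Vec d) (g x : Vec d →ₗ[ℝ] Vec d))) 0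

/-- The vector field `b : (0,T) × 𝕋ᵈ → ℝᵈ`, with spatial weak gradient `Db`, belongs to
`L¹(0,T; W^{1,p}(𝕋ᵈ)) ∩ L^∞((0,T) × 𝕋ᵈ)` and `(div b)⁻ ∈ L¹(0,T; L^∞(𝕋ᵈ))`. -/
structure IsAdmissibleVelocity {d : ℕ} (T p : ℝ) (b : ℝ → Torus d → Vec d)
    (Db : ℝ → Torus d → Vec d →L[ℝ] Vec d) : Prop where
  memLp_top : MemLp (Function.uncurry b) ⊤ (spaceTime d T)
  aestronglyMeasurable_grad : AEStronglyMeasurable (Function.uncurry Db) (spaceTime d T)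
  hasWeakGradient : ∀ᵐ t ∂(volume.restrict (Ioc 0 T)), HasWeakGradient (b t) (Db t)
  sobolev : ∫⁻ t in Ioc 0 T, (eLpNorm (b t) (ENNReal.ofReal p) volume +
    eLpNorm (Db t) (ENNReal.ofReal p) volume) < ⊤
  integrable_negDiv : ∫⁻ t in Ioc 0 T, eLpNorm (negDiv (Db t)) ⊤ volume < ⊤

/-- `γ` is an absolutely continuous solution on `[0,T]` of `γ' = b(t, γ)` in the torus, with
`γ(0) = x`: it has an absolutely continuous lift to `ℝᵈ` which solves the equation at almost
every time. -/
def IsACSolution {d : ℕ} (T : ℝ) (b : ℝ → Torus d → Vec d) (x : Torus d)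
    (γ : ℝ → Torus d) : Prop :=
  γ 0 = x ∧ ∃ c : ℝ → Vec d, AbsolutelyContinuousOnInterval c 0 T ∧
    (∀ t ∈ Icc 0 T, toTorus (c t) = γ t) ∧
    ∀ᵐ t ∂(volume.restrict (Ioc 0 T)), HasDerivAt c (b t (γ t)) t

/-- `Φ` is a regular Lagrangian flow of `b` on `[0,T]`, with compressibility constant `L`. -/
structure IsRegularLagrangianFlow {d : ℕ} (T : ℝ) (b : ℝ → Torus d → Vec d) (L : ℝ≥0)
    (Φ : ℝ → Torus d → Torus d) : Prop where
  solution : ∀ᵐ x, IsACSolution T b x (fun t => Φ t x)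
  aemeasurable : ∀ t ∈ Icc 0 T, AEMeasurable (Φ t) volume
  compressibility : ∀ t ∈ Icc 0 T, Measure.map (Φ t) volume ≤ L • (volume : Measure (Torus d))

/-- The mean velocity `⨍_{t_n}^{t_{n+1}} ⨍_Q b(s, z + y - x₀) dy ds` with `t_n = n Δt`: the average
of `b` over the `n`-th time step and over the cell `Q` translated by `z - x₀`. -/
def meanVelocity {d : ℕ} (b : ℝ → Torus d → Vec d) (Δt : ℝ) (Q : Set (Torus d))
    (x₀ z : Torus d) (n : ℕ) : Vec d :=
  ⨍ s in (n * Δt)..((n + 1) * Δt), ⨍ y in Q, b s (z + y - x₀)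

/-- The position at time `t_n = n Δt` of the point `x` of the cell `Q`, under the cell-averaged
Euler scheme; `x₀` is the point of `Q` that was fixed in advance. -/
def meanEulerNode {d : ℕ} (b : ℝ → Torus d → Vec d) (Δt : ℝ) (Q : Set (Torus d))
    (x₀ : Torus d) : ℕ → Torus d → Torus d
  | 0, x => x
  | n + 1, x => meanEulerNode b Δt Q x₀ n x +
      toTorus (Δt • meanVelocity b Δt Q x₀ (meanEulerNode b Δt Q x₀ n x₀) n)

/-- The cell-averaged Euler approximation of the flow of `b`. Here `P` is a partition of `𝕋ᵈ` into
cells `Q i` together with a choice of points `P.some i ∈ Q i`, and `P.index x` is the `i` for which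
`x ∈ Q i`. For `t_n ≤ t < t_{n+1}`, i.e. `n = ⌊t / Δt⌋`, and `x ∈ Q i`, the position at time `t` is
the position at time `t_n` plus `t - t_n` times the mean velocity. -/
def meanEulerFlow {d N : ℕ} (b : ℝ → Torus d → Vec d) (Δt : ℝ) {Q : Fin N → Set (Torus d)}
    (P : IndexedPartition Q) (t : ℝ) (x : Torus d) : Torus d :=
  let i := P.index x
  let n := ⌊t / Δt⌋₊
  meanEulerNode b Δt (Q i) (P.some i) n x +
    toTorus ((t - n * Δt) • meanVelocity b Δt (Q i) (P.some i)
      (meanEulerNode b Δt (Q i) (P.some i) n (P.some i)) n)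

end

/-! ### The torus as a quotient of Euclidean space, and shortest lifts. -/

section TorusBasics

variable {d : ℕ}

/-! The scheme has no compressibility bound, so an estimate that evaluates a maximal function along
the approximate trajectory is useless. For `d < q < p`, Morrey's estimate can be made asymmetric:
for almost all `x`, `y`, `|b(s,x) - b(s,y)| ≤ C |x - y| (M|Db|^q)^{1/q}(x)`, with the maximal
function at `x` only (`HasWeakGradient.ae_ae_enorm_sub_le`,
`IsAdmissibleVelocity.exists_lipschitz_majorant`). Taking `x` on the exact trajectory,
compressibility, Minkowski's inequality and the maximal theorem with exponent `p/q > 1` bound the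
time integral `J` of this coefficient in `L^p` (`lintegral_flowMaximal_rpow_le`).

The estimate holds for almost every `y` only, which is why the scheme averages over cells: a
translated cell of positive measure does not see null sets. The time average makes the node
displacements exact integrals of the space-averaged velocity (`eulerDisplacement_eq_integral`), so
no regularity of `b` in time is needed. With `δ = max Δt Δx`, the difference `v` of the
displacements of the exact trajectory and of the integrated cell velocity satisfies `|v'| ≤ C N (|v|
+ (B+1)δ)`, where `N` is the maximal coefficient on the exact trajectory. Logarithmic Gronwall then
bounds `log(1 + |v|/((B+1)δ))` by `C J` (`exists_trajectory_error_bound`).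

An elementary dichotomy at the threshold `√δ` turns this, together with the trivial bound `2Bt` on
the error, into a pointwise bound by `|log δ|⁻¹` times an affine function of `J` whose coefficients
vanish as `t → 0` (`le_inv_abs_log_mul`). Taking `L^p` norms finishes the proof. -/

lemma toTorus_add (v w : Vec d) : toTorus (v + w) = toTorus v + toTorus w := by
  ext i; simp [toTorus]

lemma toTorus_zero : toTorus (0 : Vec d) = 0 := by
  ext i; simp [toTorus]

lemma toTorus_neg (v : Vec d) : toTorus (-v) = -toTorus v := by
  ext i; simp [toTorus]

lemma toTorus_sub (v w : Vec d) : toTorus (v - w) = toTorus v - toTorus w := by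
  ext i; simp [toTorus]

@[fun_prop]
lemma continuous_toTorus : Continuous (toTorus : Vec d → Torus d) := by
  refine continuous_pi fun i => ?_
  exact (AddCircle.continuous_mk' 1).comp (by fun_prop : Continuous fun v : Vec d => v i)

@[fun_prop]
lemma measurable_toTorus : Measurable (toTorus : Vec d → Torus d) := continuous_toTorus.measurable

lemma isOpenQuotientMap_toTorus : IsOpenQuotientMap (toTorus : Vec d → Torus d) := by
  have h : IsOpenQuotientMap (Pi.map fun (_ : Fin d) (x : ℝ) => (x : UnitAddCircle)) :=
    IsOpenQuotientMap.piMap fun _ => QuotientAddGroup.isOpenQuotientMap_mk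
  exact h.comp (EuclideanSpace.equiv (Fin d) ℝ).toHomeomorph.isOpenQuotientMap

lemma toTorus_surjective : Function.Surjective (toTorus : Vec d → Torus d) :=
  isOpenQuotientMap_toTorus.surjective

instance : IsProbabilityMeasure (volume : Measure UnitAddCircle) :=
  ⟨by simp⟩

instance : IsProbabilityMeasure (volume : Measure (Torus d)) := by
  unfold Torus UnitAddTorus
  infer_instance

lemma torusNorm_eq_norm (z : Torus d) :
    torusNorm z = ‖(WithLp.toLp 2 z : PiLp 2 fun _ : Fin d => UnitAddCircle)‖ := by
  rw [PiLp.norm_eq_of_L2]; rfl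

lemma torusNorm_nonneg (z : Torus d) : 0 ≤ torusNorm z := Real.sqrt_nonneg _

lemma torusNorm_add_le (x y : Torus d) : torusNorm (x + y) ≤ torusNorm x + torusNorm y := by
  simp only [torusNorm_eq_norm, WithLp.toLp_add]
  exact norm_add_le _ _

lemma torusNorm_neg (x : Torus d) : torusNorm (-x) = torusNorm x := by
  simp only [torusNorm_eq_norm, WithLp.toLp_neg, norm_neg]

@[fun_prop]
lemma continuous_torusNorm : Continuous (torusNorm : Torus d → ℝ) := by
  unfold torusNorm; fun_prop

lemma torusNorm_toTorus_le (v : Vec d) : torusNorm (toTorus v) ≤ ‖v‖ := by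
  rw [EuclideanSpace.norm_eq]
  refine Real.sqrt_le_sqrt (Finset.sum_le_sum fun i _ => ?_)
  gcongr
  exact QuotientAddGroup.norm_mk_le_norm

/-- A property that holds almost everywhere on `ℝᵈ` holds at a shortest lift of almost every point
of the torus. -/
lemma ae_exists_shortest_lift {P : Vec d → Prop} (hP : ∀ᵐ h, P h) :
    ∀ᵐ z : Torus d, ∃ h : Vec d, toTorus h = z ∧ ‖h‖ = torusNorm z ∧ P h := by
  set N : Set (Vec d) := toMeasurable volume {h | ¬ P h} with hN
  have hN0 : volume N = 0 := by rw [hN, measure_toMeasurable]; exact hP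
  have hNm : MeasurableSet N := measurableSet_toMeasurable _ _
  -- Coordinates in `(-1/2, 1/2]` have absolute value equal to their circle norm, so the measurable
  -- section `σ` picks a shortest lift.
  set a : ℝ := -(1 / 2) with ha
  set σ : Torus d → Vec d := fun z =>
    WithLp.toLp 2 fun i => (AddCircle.measurableEquivIoc 1 a (z i)).1 with hσ
  have hσm : Measurable σ := by
    refine (PiLp.volume_preserving_toLp (Fin d)).measurable.comp (measurable_pi_lambda _ fun i => ?_)
    exact measurable_subtype_coe.comp
      ((AddCircle.measurableEquivIoc 1 a).measurable.comp (measurable_pi_apply i))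
  have hσ1 : ∀ z, toTorus (σ z) = z := by
    intro z; ext i
    exact (AddCircle.equivIoc 1 a).symm_apply_apply (z i)
  have hmp : MeasurePreserving (fun (x : Fin d → ℝ) => (fun i => (x i : UnitAddCircle) : Torus d))
      (Measure.pi fun _ => volume.restrict (Ioc a (a + 1))) volume :=
    measurePreserving_pi _ _ fun _ => UnitAddCircle.measurePreserving_mk a
  have h1 : ∀ᵐ z, σ z ∉ N := by
    rw [← hmp.map_eq]
    refine (ae_map_iff hmp.measurable.aemeasurable (p := fun z => σ z ∉ N) (hσm hNm).compl).2 ?_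
    rw [← Measure.restrict_pi_pi, ae_restrict_iff' (MeasurableSet.univ_pi fun _ => measurableSet_Ioc)]
    have h2 : ∀ᵐ h : Vec d, h ∉ N := measure_eq_zero_iff_ae_notMem.1 hN0
    filter_upwards [(PiLp.volume_preserving_toLp (Fin d)).quasiMeasurePreserving.ae h2] with x hx hxI
    convert hx using 2
    simp only [hσ]
    congr 1
    ext i
    have h3 : x i ∈ Ioc a (a + 1) := hxI i (mem_univ i)
    exact congrArg Subtype.val ((AddCircle.equivIoc 1 a).apply_symm_apply ⟨x i, h3⟩)
  filter_upwards [h1] with z hz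
  refine ⟨σ z, hσ1 z, ?_, ?_⟩
  · conv_rhs => rw [← hσ1 z]
    rw [EuclideanSpace.norm_eq, torusNorm]
    congr 1
    refine Finset.sum_congr rfl fun i _ => ?_
    have hi : σ z i ∈ Ioc a (a + 1) := (AddCircle.measurableEquivIoc 1 a (z i)).2
    have : ‖((σ z i : ℝ) : UnitAddCircle)‖ = |σ z i| := by
      rw [AddCircle.norm_coe_eq_abs_iff 1 one_ne_zero, abs_le]
      simp only [ha, mem_Ioc] at hi
      constructor <;> norm_num <;> linarith
    simp [toTorus, this]
  · by_contra hPz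
    exact hz (subset_toMeasurable _ _ hPz)

lemma lintegral_add_toTorus (f : Torus d → ℝ≥0∞) (v : Vec d) :
    ∫⁻ x, f (x + toTorus v) = ∫⁻ x, f x :=
  lintegral_add_right_eq_self f _

/-- For each fixed `v` the map is a translation, so Fubini applies. This transports
almost-everywhere statements from `y` to pairs `(x, h)` with `y = x + toTorus h`. -/
lemma quasiMeasurePreserving_add_toTorus :
    Measure.QuasiMeasurePreserving (fun z : Torus d × Vec d => z.1 + toTorus z.2)
      (volume.prod volume) volume := by
  refine ⟨by fun_prop, Measure.AbsolutelyContinuous.mk fun s hs h0 => ?_⟩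
  rw [Measure.map_apply (by fun_prop) hs, Measure.measure_prod_null
    ((by fun_prop : Measurable fun z : Torus d × Vec d => z.1 + toTorus z.2) hs)]
  have hm : MeasurableSet {z : Torus d × Vec d | z.1 + toTorus z.2 ∉ s} :=
    ((by fun_prop : Measurable fun z : Torus d × Vec d => z.1 + toTorus z.2) hs).compl
  have h1 : ∀ᵐ x : Torus d, ∀ᵐ v : Vec d, x + toTorus v ∉ s := by
    rw [Measure.ae_ae_comm hm]
    refine Eventually.of_forall fun v => ?_
    exact (measurePreserving_add_right volume (toTorus v)).quasiMeasurePreserving.ae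
      (measure_eq_zero_iff_ae_notMem.1 h0)
  filter_upwards [h1] with x hx
  exact measure_eq_zero_iff_ae_notMem.2 hx

end TorusBasics

/-! ### Maximal functions on Euclidean space and on the torus. -/

open Metric

/-- The maximal function of `u : ℝᵈ → [0,∞]` over the centred balls of radii `r 0, r 1, …`. -/
noncomputable def maximalAverage {d : ℕ} (r : ℕ → ℝ) (u : Vec d → ℝ≥0∞) (x : Vec d) : ℝ≥0∞ :=
  ⨆ k, (volume (closedBall (0 : Vec d) (r k)))⁻¹ * ∫⁻ w in closedBall (0 : Vec d) (r k), u (x + w)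

/-- The maximal function of `u : 𝕋ᵈ → [0,∞]` over the images of the balls of radii
`r 0, r 1, …` of `ℝᵈ`. -/
noncomputable def torusMaximal {d : ℕ} (r : ℕ → ℝ) (u : Torus d → ℝ≥0∞) (x : Torus d) : ℝ≥0∞ :=
  ⨆ k, (volume (closedBall (0 : Vec d) (r k)))⁻¹ *
    ∫⁻ w in closedBall (0 : Vec d) (r k), u (x + toTorus w)

section Maximal

variable {d : ℕ} {r : ℕ → ℝ}

lemma setLIntegral_closedBall_add (u : Vec d → ℝ≥0∞) (x : Vec d) (ρ : ℝ) :
    ∫⁻ w in closedBall (0 : Vec d) ρ, u (x + w) = ∫⁻ y in closedBall x ρ, u y := by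
  have h := (measurePreserving_add_left (volume : Measure (Vec d)) x).setLIntegral_comp_preimage_emb
    (measurableEmbedding_addLeft x) u (closedBall x ρ)
  rw [← h]
  congr 2
  ext w; simp

lemma volume_closedBall_ne_zero {ρ : ℝ} (hρ : 0 < ρ) (x : Vec d) :
    volume (closedBall x ρ) ≠ 0 := (measure_closedBall_pos _ _ hρ).ne'

lemma volume_closedBall_ne_top (ρ : ℝ) (x : Vec d) : volume (closedBall x ρ) ≠ ⊤ :=
  measure_closedBall_lt_top.ne

lemma volume_closedBall_mul {ρ c : ℝ} (hρ : 0 ≤ ρ) (hc : 0 ≤ c) (x y : Vec d) :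
    volume (closedBall x (c * ρ)) = ENNReal.ofReal (c ^ d) * volume (closedBall y ρ) := by
  rw [Measure.addHaar_closedBall _ _ (mul_nonneg hc hρ), Measure.addHaar_closedBall _ _ hρ,
    mul_pow, ENNReal.ofReal_mul (by positivity)]
  simp [mul_assoc]

lemma measurable_maximalAverage {u : Vec d → ℝ≥0∞} (hu : Measurable u) :
    Measurable (maximalAverage r u) := by
  unfold maximalAverage
  refine Measurable.iSup fun k => Measurable.const_mul ?_ _
  exact Measurable.lintegral_prod_right' (f := fun z : Vec d × Vec d => u (z.1 + z.2))
    (by fun_prop)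

/-- The weak type `(1,1)` inequality. -/
lemma mul_volume_lt_maximalAverage_le {R : ℝ} (hr : ∀ k, 0 < r k) (hR : ∀ k, r k ≤ R)
    (u : Vec d → ℝ≥0∞) (l : ℝ≥0∞) :
    l * volume {x | l < maximalAverage r u x} ≤ ENNReal.ofReal (4 ^ d) * ∫⁻ y, u y := by
  set E := {x | l < maximalAverage r u x} with hE
  have h1 : ∀ x ∈ E, ∃ k, l * volume (closedBall x (r k)) ≤ ∫⁻ y in closedBall x (r k), u y := by
    intro x hx
    obtain ⟨k, hk⟩ := lt_iSup_iff.1 (show l < ⨆ k, _ from hx)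
    refine ⟨k, ?_⟩
    rw [setLIntegral_closedBall_add] at hk
    have h0 := volume_closedBall_ne_zero (hr k) (0 : Vec d)
    have ht := volume_closedBall_ne_top (r k) (0 : Vec d)
    have h2 : volume (closedBall x (r k)) = volume (closedBall (0 : Vec d) (r k)) := by
      simpa using volume_closedBall_mul (hr k).le zero_le_one x (0 : Vec d)
    rw [h2, mul_comm]
    calc _ ≤ volume (closedBall (0 : Vec d) (r k)) *
        ((volume (closedBall (0 : Vec d) (r k)))⁻¹ * ∫⁻ y in closedBall x (r k), u y) := by gcongr
      _ = _ := by rw [← mul_assoc, ENNReal.mul_inv_cancel h0 ht, one_mul]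
  choose! k hk using h1
  -- The covering theorem needs bounded radii and an enlargement factor greater than 3; the choice 4
  -- produces the constant `4 ^ d`.
  obtain ⟨t, htE, htd, htc⟩ := Vitali.exists_disjoint_subfamily_covering_enlargement_closedBall
    E id (fun x => r (k x)) R (fun a _ => hR _) 4 (by norm_num)
  have htcount : t.Countable := htd.countable_of_nonempty_interior fun x hx => by
    refine ⟨x, ?_⟩
    exact (ball_subset_interior_closedBall (mem_ball_self (hr _)))
  have hcov : E ⊆ ⋃ b ∈ t, closedBall b (4 * r (k b)) := by
    intro x hx
    obtain ⟨b, hb, hxb⟩ := htc x hx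
    exact mem_biUnion hb (hxb (mem_closedBall_self (hr _).le))
  have := htcount.to_subtype
  calc l * volume E ≤ l * ∑' b : t, volume (closedBall (b : Vec d) (4 * r (k b))) := by
        gcongr
        exact (measure_mono hcov).trans (measure_biUnion_le _ htcount _)
    _ = ∑' b : t, ENNReal.ofReal (4 ^ d) * (l * volume (closedBall (b : Vec d) (r (k b)))) := by
        rw [← ENNReal.tsum_mul_left]
        refine tsum_congr fun b => ?_
        rw [volume_closedBall_mul (hr _).le (by norm_num) _ (b : Vec d)]
        ring
    _ ≤ ∑' b : t, ENNReal.ofReal (4 ^ d) * ∫⁻ y in closedBall (b : Vec d) (r (k b)), u y := by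
        refine ENNReal.tsum_le_tsum fun b => ?_
        gcongr
        exact hk b (htE b.2)
    _ = ENNReal.ofReal (4 ^ d) * ∫⁻ y in ⋃ b : t, closedBall (b : Vec d) (r (k b)), u y := by
        rw [ENNReal.tsum_mul_left, lintegral_iUnion (fun b => measurableSet_closedBall)]
        exact fun a b hab => htd a.2 b.2 (fun h => hab (Subtype.ext h))
    _ ≤ _ := by gcongr; exact Measure.restrict_le_self

/-- The part of `u` below level `l` adds at most `l` to any average, so an average above `2 * l`
forces the maximal function of the part above `l` to exceed `l`; the weak type bound applies to that
part. -/
lemma mul_volume_two_mul_lt_maximalAverage_le {R : ℝ} (hr : ∀ k, 0 < r k) (hR : ∀ k, r k ≤ R)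
    (u : Vec d → ℝ≥0∞) (l : ℝ≥0∞) :
    l * volume {x | 2 * l < maximalAverage r u x} ≤
      ENNReal.ofReal (4 ^ d) * ∫⁻ y, {y | l < u y}.indicator u y := by
  refine le_trans ?_ (mul_volume_lt_maximalAverage_le hr hR _ l)
  refine mul_le_mul_right (measure_mono fun x hx => ?_) _
  have h1 : maximalAverage r u x ≤ maximalAverage r ({y | l < u y}.indicator u) x + l := by
    refine iSup_le fun k => ?_
    have h0 := volume_closedBall_ne_zero (hr k) (0 : Vec d)
    have ht := volume_closedBall_ne_top (r k) (0 : Vec d)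
    have h2 : ∀ y, u y ≤ {y | l < u y}.indicator u y + l := by
      intro y
      by_cases hy : l < u y
      · simp [indicator, hy]
      · simpa [indicator, hy] using not_lt.1 hy
    calc _ ≤ (volume (closedBall (0 : Vec d) (r k)))⁻¹ * ∫⁻ w in closedBall (0 : Vec d) (r k),
          ({y | l < u y}.indicator u (x + w) + l) := by gcongr; exact h2 _
      _ = (volume (closedBall (0 : Vec d) (r k)))⁻¹ * (∫⁻ w in closedBall (0 : Vec d) (r k),
          {y | l < u y}.indicator u (x + w)) + l := by
        rw [lintegral_add_right _ measurable_const, setLIntegral_const, mul_add,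
          mul_comm l, ← mul_assoc _ _ l, ENNReal.inv_mul_cancel h0 ht, one_mul]
      _ ≤ _ := by gcongr; exact le_iSup (fun k => (volume (closedBall (0 : Vec d) (r k)))⁻¹ *
          ∫⁻ w in closedBall (0 : Vec d) (r k), {y | l < u y}.indicator u (x + w)) k
  by_contra hlt
  have h3 : maximalAverage r u x ≤ l + l := h1.trans (by gcongr; exact not_lt.1 hlt)
  rw [← two_mul] at h3
  exact absurd (show 2 * l < maximalAverage r u x from hx) (not_lt.2 h3)

/-- Layer-cake formula for a single value, infinity included. It is used twice below, with exponents
`s` and `s - 1`. -/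
lemma lintegral_indicator_rpow_eq {s : ℝ} (hs : 0 < s) (a : ℝ≥0∞) :
    ∫⁻ t in Ioi (0 : ℝ), {t : ℝ | ENNReal.ofReal t < a}.indicator
      (fun t => ENNReal.ofReal (s * t ^ (s - 1))) t = a ^ s := by
  have key : ∀ b : ℝ, 0 ≤ b → ∫⁻ t in Ioo 0 b, ENNReal.ofReal (s * t ^ (s - 1)) =
      ENNReal.ofReal b ^ s := by
    intro b hb
    have hi : IntervalIntegrable (fun t : ℝ => s * t ^ (s - 1)) volume 0 b :=
      (intervalIntegral.intervalIntegrable_rpow' (by linarith)).const_mul s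
    rw [setLIntegral_congr Ioo_ae_eq_Ioc, ← ofReal_integral_eq_lintegral_ofReal,
      ← intervalIntegral.integral_of_le hb, intervalIntegral.integral_const_mul,
      integral_rpow (Or.inl (by linarith)), ENNReal.ofReal_rpow_of_nonneg hb hs.le]
    · congr 1
      rw [sub_add_cancel, Real.zero_rpow hs.ne']
      field_simp
      ring
    · exact (intervalIntegrable_iff_integrableOn_Ioc_of_le hb).1 hi
    · filter_upwards [ae_restrict_mem measurableSet_Ioc] with t ht
      have := ht.1
      positivity
  rw [lintegral_indicator (measurableSet_lt ENNReal.measurable_ofReal measurable_const),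
    Measure.restrict_restrict (measurableSet_lt ENNReal.measurable_ofReal measurable_const)]
  induction a with
  | top =>
    have h1 : {t : ℝ | ENNReal.ofReal t < ⊤} ∩ Ioi 0 = Ioi 0 := by ext; simp
    rw [h1, ENNReal.top_rpow_of_pos hs]
    refine ENNReal.eq_top_of_forall_nnreal_le fun b => ?_
    have h2 := key ((b : ℝ) ^ (1 / s)) (by positivity)
    calc (b : ℝ≥0∞) = ENNReal.ofReal ((b : ℝ) ^ (1 / s)) ^ s := by
          rw [ENNReal.ofReal_rpow_of_nonneg (by positivity) hs.le, ← Real.rpow_mul (by positivity),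
            one_div_mul_cancel hs.ne', Real.rpow_one, ENNReal.ofReal_coe_nnreal]
      _ ≤ _ := by rw [← h2]; exact lintegral_mono_set Ioo_subset_Ioi_self
  | coe b =>
    have h1 : {t : ℝ | ENNReal.ofReal t < b} ∩ Ioi 0 = Ioo 0 (b : ℝ) := by
      ext t
      simp only [mem_inter_iff, mem_ofPred_eq, mem_Ioi, mem_Ioo]
      rw [and_comm]
      refine and_congr_right fun ht => ?_
      rw [← ENNReal.ofReal_coe_nnreal, ENNReal.ofReal_lt_ofReal_iff_of_nonneg ht.le]
    rw [h1, key b b.2, ENNReal.ofReal_coe_nnreal]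

/-- The strong type inequality for the maximal function. -/
lemma lintegral_maximalAverage_rpow_le {R s : ℝ} (hs : 1 < s) (hr : ∀ k, 0 < r k)
    (hR : ∀ k, r k ≤ R) {u : Vec d → ℝ≥0∞} (hu : Measurable u) :
    ∫⁻ x, maximalAverage r u x ^ s ≤
      ENNReal.ofReal (2 ^ s * 4 ^ d * (s / (s - 1))) * ∫⁻ y, u y ^ s := by
  have hs0 : 0 < s := by linarith
  have hs1 : 0 < s - 1 := by linarith
  set m := maximalAverage r u with hm
  have hmm : Measurable m := measurable_maximalAverage hu
  -- At level `t`, the truncated weak type bound trades the measure of `{m > 2t}` for `t⁻¹` times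
  -- the integral of `u` over `{u > t}`. Since `s t^(s-1) / t` is `s/(s-1)` times the layer-cake
  -- density of `u^(s-1)`, integrating in `t` gives `u * u^(s-1)`.
  have hl : ∀ t ∈ Ioi (0 : ℝ), ∫⁻ x, {t : ℝ | ENNReal.ofReal t < m x / 2}.indicator
      (fun t => ENNReal.ofReal (s * t ^ (s - 1))) t ≤ ENNReal.ofReal (4 ^ d * (s / (s - 1))) *
      ∫⁻ y, u y * {t : ℝ | ENNReal.ofReal t < u y}.indicator
        (fun t => ENNReal.ofReal ((s - 1) * t ^ (s - 1 - 1))) t := by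
    intro t ht
    have ht : 0 < t := ht
    have h1 : ∀ x, {t : ℝ | ENNReal.ofReal t < m x / 2}.indicator
        (fun t => ENNReal.ofReal (s * t ^ (s - 1))) t =
        {x | 2 * ENNReal.ofReal t < m x}.indicator
          (fun _ => ENNReal.ofReal (s * t ^ (s - 1))) x := by
      intro x
      simp only [indicator, mem_ofPred_eq, ENNReal.lt_div_iff_mul_lt (Or.inl two_ne_zero)
        (Or.inl ENNReal.ofNat_ne_top), mul_comm]
    have h2 : ∀ y, u y * {t : ℝ | ENNReal.ofReal t < u y}.indicator
        (fun t => ENNReal.ofReal ((s - 1) * t ^ (s - 1 - 1))) t =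
        ENNReal.ofReal ((s - 1) * t ^ (s - 1 - 1)) *
          {y | ENNReal.ofReal t < u y}.indicator u y := by
      intro y
      by_cases h : ENNReal.ofReal t < u y <;> simp [indicator, h, mul_comm]
    simp_rw [h1, h2]
    have hset : MeasurableSet {x | 2 * ENNReal.ofReal t < m x} :=
      measurableSet_lt measurable_const hmm
    have hset' : MeasurableSet {x | ENNReal.ofReal t < u x} :=
      measurableSet_lt measurable_const hu
    rw [lintegral_indicator_const hset, lintegral_const_mul _ (hu.indicator hset')]
    have h3 : s * t ^ (s - 1) = (s / (s - 1)) * ((s - 1) * t ^ (s - 1 - 1)) * t := by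
      rw [Real.rpow_sub_one ht.ne' (s - 1)]
      field_simp
    calc _ = ENNReal.ofReal ((s / (s - 1)) * ((s - 1) * t ^ (s - 1 - 1))) *
          (ENNReal.ofReal t * volume {x | 2 * ENNReal.ofReal t < m x}) := by
          rw [h3, ENNReal.ofReal_mul (by positivity), mul_assoc]
      _ ≤ ENNReal.ofReal ((s / (s - 1)) * ((s - 1) * t ^ (s - 1 - 1))) *
          (ENNReal.ofReal (4 ^ d) * ∫⁻ y, {y | ENNReal.ofReal t < u y}.indicator u y) := by
          exact mul_le_mul_right (mul_volume_two_mul_lt_maximalAverage_le hr hR u _) _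
      _ = _ := by
          rw [ENNReal.ofReal_mul (p := s / (s - 1)) (by positivity),
            ENNReal.ofReal_mul (p := 4 ^ d) (by positivity)]
          ring
  have meas : ∀ (e : ℝ) (v : Vec d → ℝ≥0∞), Measurable v →
      Measurable fun z : ℝ × Vec d => {t : ℝ | ENNReal.ofReal t < v z.2}.indicator
        (fun t => ENNReal.ofReal ((e * t ^ (e - 1)))) z.1 := by
    intro e v hv
    have : (fun z : ℝ × Vec d => {t : ℝ | ENNReal.ofReal t < v z.2}.indicator
        (fun t => ENNReal.ofReal ((e * t ^ (e - 1)))) z.1) =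
        {z : ℝ × Vec d | ENNReal.ofReal z.1 < v z.2}.indicator
          (fun z => ENNReal.ofReal ((e * z.1 ^ (e - 1)))) := by
      ext z; simp [indicator]
    rw [this]
    exact Measurable.indicator (by fun_prop) (measurableSet_lt (by fun_prop) (by fun_prop))
  calc ∫⁻ x, m x ^ s = 2 ^ s * ∫⁻ x, (m x / 2) ^ s := by
        rw [← lintegral_const_mul _ (by fun_prop)]
        refine lintegral_congr fun x => ?_
        rw [← ENNReal.mul_rpow_of_nonneg _ _ hs0.le,
          ENNReal.mul_div_cancel two_ne_zero ENNReal.ofNat_ne_top]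
    _ = 2 ^ s * ∫⁻ t in Ioi (0 : ℝ), ∫⁻ x, {t : ℝ | ENNReal.ofReal t < m x / 2}.indicator
          (fun t => ENNReal.ofReal (s * t ^ (s - 1))) t := by
        rw [lintegral_lintegral_swap (meas s _ (hmm.div_const 2)).aemeasurable]
        congr 1
        exact lintegral_congr fun x => (lintegral_indicator_rpow_eq hs0 _).symm
    _ ≤ 2 ^ s * ∫⁻ t in Ioi (0 : ℝ), ENNReal.ofReal (4 ^ d * (s / (s - 1))) *
          ∫⁻ y, u y * {t : ℝ | ENNReal.ofReal t < u y}.indicator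
          (fun t => ENNReal.ofReal ((s - 1) * t ^ (s - 1 - 1))) t := by
        gcongr 2 ^ s * ?_
        exact setLIntegral_mono' measurableSet_Ioi hl
    _ = 2 ^ s * (ENNReal.ofReal (4 ^ d * (s / (s - 1))) * ∫⁻ y, u y * u y ^ (s - 1)) := by
        have hM : Measurable fun z : ℝ × Vec d => u z.2 * {t : ℝ | ENNReal.ofReal t < u z.2}.indicator
            (fun t => ENNReal.ofReal ((s - 1) * t ^ (s - 1 - 1))) z.1 :=
          (hu.comp measurable_snd).mul (meas (s - 1) u hu)
        rw [lintegral_const_mul _ hM.lintegral_prod_right', lintegral_lintegral_swap hM.aemeasurable]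
        congr 2
        refine lintegral_congr fun y => ?_
        have hy := (meas (s - 1) u hu).comp (measurable_prodMk_right (y := y))
        simp only [Function.comp_def] at hy
        dsimp only
        rw [lintegral_const_mul _ hy, lintegral_indicator_rpow_eq hs1]
    _ = _ := by
        rw [← mul_assoc]
        congr 1
        · rw [mul_assoc (2 ^ s : ℝ), ENNReal.ofReal_mul (p := 2 ^ s) (by positivity),
            ← ENNReal.ofReal_rpow_of_nonneg (by norm_num) hs0.le]
          norm_num
        · refine lintegral_congr fun y => ?_
          conv_lhs => rw [← ENNReal.rpow_one (u y)]
          rw [← ENNReal.rpow_mul, one_mul, ← ENNReal.rpow_add_of_nonneg _ _ zero_le_one hs1.le]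
          congr 1; ring

lemma measurable_torusMaximal {u : Torus d → ℝ≥0∞} (hu : Measurable u) :
    Measurable (torusMaximal r u) := by
  unfold torusMaximal
  refine Measurable.iSup fun k => Measurable.const_mul ?_ _
  exact Measurable.lintegral_prod_right' (f := fun z : Torus d × Vec d => u (z.1 + toTorus z.2))
    (by fun_prop)

/-- The strong type inequality for the maximal function on the torus, by transference. -/
lemma lintegral_torusMaximal_rpow_le {R s : ℝ} (hs : 1 < s) (hr : ∀ k, 0 < r k)
    (hR : ∀ k, r k ≤ R) {u : Torus d → ℝ≥0∞} (hu : Measurable u) :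
    ∫⁻ x, torusMaximal r u x ^ s ≤
      ENNReal.ofReal (2 ^ s * 4 ^ d * (s / (s - 1)) * (1 + R) ^ d) * ∫⁻ y, u y ^ s := by
  have hR0 : 0 < R := (hr 0).trans_le (hR 0)
  have hs0 : 0 < s := by linarith
  have hs1 : 0 < s - 1 := by linarith
  set C : ℝ≥0∞ := ENNReal.ofReal (2 ^ s * 4 ^ d * (s / (s - 1))) with hC
  have hm := measurable_torusMaximal (r := r) hu
  have hx : ∀ x : Torus d, ∫⁻ h in closedBall (0 : Vec d) 1, torusMaximal r u (x + toTorus h) ^ s ≤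
      C * ∫⁻ h in closedBall (0 : Vec d) (1 + R), u (x + toTorus h) ^ s := by
    intro x
    -- Averages centred in the unit ball with radii at most `R` only see the ball of radius `1 + R`,
    -- so truncating there changes nothing and makes the Euclidean inequality effective.
    set v : Vec d → ℝ≥0∞ :=
      (closedBall (0 : Vec d) (1 + R)).indicator fun h => u (x + toTorus h) with hv
    have hvm : Measurable v := Measurable.indicator (by fun_prop) measurableSet_closedBall
    have h1 : ∀ h ∈ closedBall (0 : Vec d) 1,
        torusMaximal r u (x + toTorus h) ^ s = maximalAverage r v h ^ s := by
      intro h hh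
      congr 1
      refine iSup_congr fun k => ?_
      congr 1
      refine setLIntegral_congr_fun measurableSet_closedBall fun w hw => ?_
      have : h + w ∈ closedBall (0 : Vec d) (1 + R) := by
        rw [mem_closedBall_zero_iff] at *
        exact (norm_add_le _ _).trans (add_le_add hh (hw.trans (hR k)))
      simp only [hv, indicator_of_mem this, toTorus_add, add_assoc]
    calc _ = ∫⁻ h in closedBall (0 : Vec d) 1, maximalAverage r v h ^ s :=
          setLIntegral_congr_fun measurableSet_closedBall h1
      _ ≤ ∫⁻ h, maximalAverage r v h ^ s := setLIntegral_le_lintegral _ _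
      _ ≤ C * ∫⁻ h, v h ^ s := lintegral_maximalAverage_rpow_le hs hr hR hvm
      _ = _ := by
          rw [← lintegral_indicator measurableSet_closedBall]
          congr 2
          ext h
          by_cases hh : h ∈ closedBall (0 : Vec d) (1 + R)
          · simp only [hv, indicator_of_mem hh]
          · simp only [hv, indicator_of_notMem hh, ENNReal.zero_rpow_of_pos hs0]
  have swap : ∀ (f : Torus d → ℝ≥0∞) (ρ : ℝ), Measurable f →
      ∫⁻ x, ∫⁻ h in closedBall (0 : Vec d) ρ, f (x + toTorus h) =
        volume (closedBall (0 : Vec d) ρ) * ∫⁻ x, f x := by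
    intro f ρ hf
    rw [lintegral_lintegral_swap (Measurable.aemeasurable (by fun_prop))]
    simp_rw [lintegral_add_toTorus f]
    rw [setLIntegral_const, mul_comm]
  -- Integrating over the base point removes the translations; the ratio of the two ball volumes is
  -- the factor `(1 + R) ^ d`.
  have h2 : volume (closedBall (0 : Vec d) 1) * ∫⁻ x, torusMaximal r u x ^ s ≤
      C * (volume (closedBall (0 : Vec d) (1 + R)) * ∫⁻ y, u y ^ s) := by
    rw [← swap _ 1 (hm.pow_const s), ← swap _ (1 + R) (hu.pow_const s), ← lintegral_const_mul]
    · exact lintegral_mono hx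
    · exact Measurable.lintegral_prod_right'
        (f := fun z : Torus d × Vec d => u (z.1 + toTorus z.2) ^ s) (by fun_prop)
  have h3 : volume (closedBall (0 : Vec d) (1 + R)) =
      ENNReal.ofReal ((1 + R) ^ d) * volume (closedBall (0 : Vec d) 1) := by
    simpa using volume_closedBall_mul zero_le_one (by positivity : 0 ≤ 1 + R) (0 : Vec d) 0
  rw [h3] at h2
  have h0 := volume_closedBall_ne_zero one_pos (0 : Vec d)
  have ht := volume_closedBall_ne_top 1 (0 : Vec d)
  rw [← ENNReal.mul_le_mul_iff_right h0 ht]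
  refine h2.trans (le_of_eq ?_)
  rw [ENNReal.ofReal_mul (q := (1 + R) ^ d) (by positivity)]
  ring

end Maximal

/-! ### Weak gradients integrated along segments. -/

section WeakGradient

variable {d : ℕ}

/-- The algebra of smooth functions on the torus. -/
def smoothTorusFunctions (d : ℕ) : Subalgebra ℝ C(Torus d, ℝ) where
  carrier := {φ | ContDiff ℝ ∞ fun w : Vec d => φ (toTorus w)}
  mul_mem' ha hb := by
    rw [mem_ofPred_eq] at *
    exact ha.mul hb
  add_mem' ha hb := by
    rw [mem_ofPred_eq] at *
    exact ha.add hb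
  algebraMap_mem' _ := by
    rw [mem_ofPred_eq]
    exact contDiff_const

/-- Real and imaginary parts of the first character of each coordinate are smooth and separate
points, as Stone–Weierstrass requires. -/
lemma smoothTorusFunctions_separatesPoints : (smoothTorusFunctions d).SeparatesPoints := by
  intro x y hxy
  obtain ⟨i, hi⟩ := Function.ne_iff.1 hxy
  have hc : Continuous fun z : Torus d => fourier 1 (z i) :=
    (fourier (T := 1) 1).continuous.comp (continuous_apply i)
  have hs : ContDiff ℝ ∞ fun w : Vec d => fourier (T := 1) 1 (toTorus w i) := by
    have : (fun w : Vec d => fourier (T := 1) 1 (toTorus w i)) =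
        fun w : Vec d => Complex.exp (2 * Real.pi * Complex.I * ((w i : ℝ) : ℂ)) := by
      ext w
      simp only [toTorus]
      rw [fourier_coe_apply]
      simp
    rw [this]
    have h1 : ContDiff ℝ ∞ fun w : Vec d => ((w i : ℝ) : ℂ) :=
      Complex.ofRealCLM.contDiff.comp (by fun_prop)
    exact (contDiff_const.mul h1).cexp
  have hne : fourier 1 (x i) ≠ fourier 1 (y i) := by
    intro h
    rw [fourier_one, fourier_one] at h
    exact hi (AddCircle.injective_toCircle one_ne_zero (Subtype.ext h))
  by_cases hre : (fourier 1 (x i)).re = (fourier 1 (y i)).re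
  · refine ⟨_, ⟨⟨fun z => (fourier 1 (z i)).im, Complex.continuous_im.comp hc⟩, ?_, rfl⟩, ?_⟩
    · exact Complex.imCLM.contDiff.comp hs
    · exact fun him => hne (Complex.ext hre him)
  · refine ⟨_, ⟨⟨fun z => (fourier 1 (z i)).re, Complex.continuous_re.comp hc⟩, ?_, rfl⟩, hre⟩
    exact Complex.reCLM.contDiff.comp hs

/-- Smooth functions on the torus detect integrable functions. -/
lemma ae_eq_zero_of_forall_integral_smooth_smul_eq_zero {h : Torus d → Vec d}
    (hh : Integrable h) (hz : ∀ φ ∈ smoothTorusFunctions d, ∫ x, φ x • h x = 0) :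
    h =ᵐ[volume] 0 := by
  have hint : ∀ φ : C(Torus d, ℝ), Integrable fun x => φ x • h x := fun φ =>
    hh.bdd_smul ‖φ‖ φ.continuous.aestronglyMeasurable
      (Eventually.of_forall fun x => φ.norm_coe_le_norm x)
  have hlip : LipschitzWith (∫ x, ‖h x‖).toNNReal fun φ : C(Torus d, ℝ) => ∫ x, φ x • h x := by
    refine LipschitzWith.of_dist_le_mul fun φ ψ => ?_
    rw [dist_eq_norm, ← integral_sub (hint φ) (hint ψ),
      Real.coe_toNNReal _ (integral_nonneg fun _ => norm_nonneg _), mul_comm,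
      ← integral_const_mul]
    refine norm_integral_le_of_norm_le (hh.norm.const_mul _) (Eventually.of_forall fun x => ?_)
    rw [← sub_smul, norm_smul, dist_eq_norm]
    gcongr
    exact (φ - ψ).norm_coe_le_norm x
  have hcl : IsClosed {φ : C(Torus d, ℝ) | ∫ x, φ x • h x = 0} :=
    isClosed_eq hlip.continuous continuous_const
  have hall : ∀ φ : C(Torus d, ℝ), ∫ x, φ x • h x = 0 := by
    intro φ
    have h1 : φ ∈ (smoothTorusFunctions d).topologicalClosure := by
      rw [ContinuousMap.subalgebra_topologicalClosure_eq_top_of_separatesPoints _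
        smoothTorusFunctions_separatesPoints]
      trivial
    exact closure_minimal (fun ψ hψ => hz ψ hψ) hcl h1
  -- Indicators of closed sets are bounded pointwise limits of continuous functions, so the
  -- vanishing passes to integrals over closed sets.
  refine ae_eq_zero_of_forall_setIntegral_isClosed_eq_zero hh fun F hF => ?_
  have h1 : Tendsto (fun n => ∫ x, ((hF.apprSeq n x : ℝ≥0) : ℝ) • h x) atTop
      (𝓝 (∫ x, F.indicator h x)) := by
    refine tendsto_integral_of_dominated_convergence (fun x => ‖h x‖) (fun n => ?_) hh.norm
      (fun n => Eventually.of_forall fun x => ?_) (Eventually.of_forall fun x => ?_)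
    · exact (NNReal.continuous_coe.comp (hF.apprSeq n).continuous).aestronglyMeasurable.smul
        hh.aestronglyMeasurable
    · rw [norm_smul]
      have : ‖((hF.apprSeq n x : ℝ≥0) : ℝ)‖ ≤ 1 := by
        simpa using HasOuterApproxClosed.apprSeq_apply_le_one hF n x
      nlinarith [norm_nonneg (h x)]
    · have h2 := (tendsto_pi_nhds.1 (HasOuterApproxClosed.tendsto_apprSeq hF)) x
      have h3 := ((NNReal.continuous_coe.tendsto _).comp h2).smul_const (h x)
      have h5 : F.indicator h x = ((F.indicator (fun _ => 1) x : ℝ≥0) : ℝ) • h x := by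
        by_cases hx : x ∈ F <;> simp [hx]
      rw [h5]
      exact h3
  have h4 : ∀ n, ∫ x, ((hF.apprSeq n x : ℝ≥0) : ℝ) • h x = 0 := fun n =>
    hall ⟨fun x => ((hF.apprSeq n x : ℝ≥0) : ℝ),
      NNReal.continuous_coe.comp (hF.apprSeq n).continuous⟩
  simp_rw [h4] at h1
  rw [← integral_indicator hF.measurableSet]
  exact (tendsto_nhds_unique h1 tendsto_const_nhds)

/-- The directional derivative of a function on the torus. -/
noncomputable def torusDeriv (v : Vec d) (φ : Torus d → ℝ) (x : Torus d) : ℝ :=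
  deriv (fun s : ℝ => φ (x + toTorus (s • v))) 0

lemma hasDerivAt_smooth_line {φ : Torus d → ℝ} (hφ : ContDiff ℝ ∞ fun w : Vec d => φ (toTorus w))
    (v : Vec d) (x : Torus d) (t : ℝ) :
    HasDerivAt (fun s : ℝ => φ (x + toTorus (s • v))) (torusDeriv v φ (x + toTorus (t • v))) t := by
  obtain ⟨w, rfl⟩ := toTorus_surjective x
  have key : ∀ (w : Vec d) (t : ℝ), HasDerivAt (fun s : ℝ => φ (toTorus w + toTorus (s • v)))
      (fderiv ℝ (fun w : Vec d => φ (toTorus w)) (w + t • v) v) t := by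
    intro w t
    have h1 := (hφ.differentiable (by simp)).differentiableAt (x := w + t • v)
    have h2 : HasDerivAt (fun s : ℝ => w + s • v) v t := by
      simpa using ((hasDerivAt_id t).smul_const v).const_add w
    simpa [Function.comp_def, toTorus_add] using h1.hasFDerivAt.comp_hasDerivAt t h2
  have h3 := (key (w + t • v) 0).deriv
  rw [zero_smul, add_zero, toTorus_add] at h3
  rw [torusDeriv, h3]
  exact key w t

lemma continuous_torusDeriv {φ : Torus d → ℝ} (hφ : ContDiff ℝ ∞ fun w : Vec d => φ (toTorus w))
    (v : Vec d) : Continuous (torusDeriv v φ) := by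
  rw [← isOpenQuotientMap_toTorus.continuous_comp_iff]
  have : torusDeriv v φ ∘ toTorus = fun w => fderiv ℝ (fun w : Vec d => φ (toTorus w)) w v := by
    ext w
    have h1 := (hφ.differentiable (by simp)).differentiableAt (x := w + (0 : ℝ) • v)
    have h2 : HasDerivAt (fun s : ℝ => w + s • v) v 0 := by
      simpa using ((hasDerivAt_id (0 : ℝ)).smul_const v).const_add w
    have h3 := (h1.hasFDerivAt.comp_hasDerivAt (0 : ℝ) h2).deriv
    simpa [Function.comp_def, toTorus_add, torusDeriv] using h3
  rw [this]
  exact (hφ.continuous_fderiv (by simp)).clm_apply continuous_const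

lemma measurePreserving_shear (v : Vec d) (μ : Measure ℝ) [SFinite μ] :
    MeasurePreserving (fun z : Torus d × ℝ => (z.1 + toTorus (z.2 • v), z.2))
      (volume.prod μ) (volume.prod μ) := by
  have h : MeasurePreserving (fun z : ℝ × Torus d => (z.1, z.2 + toTorus (z.1 • v)))
      (μ.prod volume) (μ.prod volume) := by
    refine (MeasurePreserving.id μ).skew_product (g := fun (t : ℝ) x => x + toTorus (t • v))
      (by fun_prop) (Eventually.of_forall fun t => ?_)
    exact (measurePreserving_add_right volume (toTorus (t • v))).map_eq
  exact (Measure.measurePreserving_swap (μ := μ) (ν := volume)).comp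
    (h.comp (Measure.measurePreserving_swap (μ := volume) (ν := μ)))

/-- A function with a weak gradient is, along almost every segment of a given direction, the
integral of its gradient. -/
lemma HasWeakGradient.ae_sub_eq_integral {f : Torus d → Vec d} {g : Torus d → Vec d →L[ℝ] Vec d}
    (hfg : HasWeakGradient f g) (hf : Integrable f) (hg : Integrable g) (v : Vec d) :
    ∀ᵐ x, f (x + toTorus v) - f x = ∫ t in Ioc (0 : ℝ) 1, g (x + toTorus (t • v)) v := by
  set μ : Measure ℝ := volume.restrict (Ioc (0 : ℝ) 1) with hμ
  have hgv : Integrable fun x => g x v := hg.apply_continuousLinearMap v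
  have hG : Integrable (fun z : Torus d × ℝ => g (z.1 + toTorus (z.2 • v)) v) (volume.prod μ) :=
    (measurePreserving_shear v μ).integrable_comp_of_integrable (hgv.comp_fst μ)
  have hfv : Integrable fun x => f (x + toTorus v) := hf.comp_add_right _
  have hGi : Integrable fun x => ∫ t, g (x + toTorus (t • v)) v ∂μ := hG.integral_prod_left
  have hmain := ae_eq_zero_of_forall_integral_smooth_smul_eq_zero
    (h := fun x => (f (x + toTorus v) - f x) - ∫ t, g (x + toTorus (t • v)) v ∂μ)
    ((hfv.sub hf).sub hGi) ?_
  · filter_upwards [hmain] with x hx using sub_eq_zero.1 hx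
  intro φ hφ
  have hφ' : ContDiff ℝ ∞ fun w : Vec d => φ (toTorus w) := hφ
  have hsm : ∀ {k : Torus d → Vec d} (ψ : C(Torus d, ℝ)), Integrable k →
      Integrable fun x => ψ x • k x := fun ψ hk =>
    hk.bdd_smul ‖ψ‖ ψ.continuous.aestronglyMeasurable
      (Eventually.of_forall fun x => ψ.norm_coe_le_norm x)
  set D : C(Torus d, ℝ) := ⟨torusDeriv v φ, continuous_torusDeriv hφ' v⟩ with hD
  have hcm : ∀ ψ : C(Torus d, ℝ), Continuous fun z : Torus d × ℝ => ψ (z.1 - toTorus (z.2 • v)) :=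
    fun ψ => ψ.continuous.comp (by fun_prop)
  have hb : ∀ {k : Torus d → Vec d} (ψ : C(Torus d, ℝ)), Integrable k →
      Integrable (fun z : Torus d × ℝ => ψ (z.1 - toTorus (z.2 • v)) • k z.1) (volume.prod μ) :=
    fun ψ hk => (hk.comp_fst μ).bdd_smul ‖ψ‖ (hcm ψ).aestronglyMeasurable
      (Eventually.of_forall fun x => ψ.norm_coe_le_norm _)
  have e1 : ∫ x, φ x • (f (x + toTorus v) - f x) = ∫ x, (φ (x - toTorus v) - φ x) • f x := by
    have h1 : ∫ x, φ x • f (x + toTorus v) = ∫ x, φ (x - toTorus v) • f x := by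
      rw [← integral_add_right_eq_self (fun x => φ (x - toTorus v) • f x) (toTorus v)]
      simp
    simp_rw [smul_sub, sub_smul]
    rw [integral_sub (hsm φ hfv) (hsm φ hf), h1, integral_sub _ (hsm φ hf)]
    exact hsm (φ.comp ⟨fun x => x - toTorus v, by fun_prop⟩) hf
  -- The difference quotient is moved onto the test function, where the classical fundamental
  -- theorem of calculus holds. The weak gradient is then tested against each translate of `φ`
  -- (`e3`) and the translation is undone (`e4`).
  have e2 : ∀ x, φ (x - toTorus v) - φ x = -∫ t, D (x - toTorus (t • v)) ∂μ := by
    intro x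
    have h1 : ∀ t : ℝ, HasDerivAt (fun s : ℝ => φ (x - toTorus (s • v)))
        (-D (x - toTorus (t • v))) t := by
      intro t
      have h2 := (hasDerivAt_smooth_line hφ' v x (-t)).scomp t (hasDerivAt_neg t)
      simpa [Function.comp_def, toTorus_neg, sub_eq_add_neg, hD] using h2
    have hc : Continuous fun t : ℝ => -D (x - toTorus (t • v)) :=
      (D.continuous.comp (by fun_prop)).neg
    have h3 := intervalIntegral.integral_eq_sub_of_hasDerivAt (a := 0) (b := 1)
      (fun t _ => h1 t) (hc.intervalIntegrable 0 1)
    rw [intervalIntegral.integral_of_le zero_le_one, integral_neg] at h3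
    simpa [toTorus_zero] using h3.symm
  have e3 : ∀ t : ℝ, ∫ x, D (x - toTorus (t • v)) • f x =
      -∫ x, φ (x - toTorus (t • v)) • g x v := by
    intro t
    have h1 := hfg (fun x => φ (x - toTorus (t • v))) (by
      have : ContDiff ℝ ∞ fun w : Vec d => φ (toTorus (w - t • v)) :=
        hφ'.comp (contDiff_id.sub contDiff_const)
      simpa only [toTorus_sub] using this) v
    rw [← h1]
    refine integral_congr_ae (Eventually.of_forall fun x => ?_)
    simp only [hD, ContinuousMap.coe_mk, torusDeriv]
    congr 2
    ext s
    congr 1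
    abel
  have e4 : ∀ t : ℝ, ∫ x, φ (x - toTorus (t • v)) • g x v =
      ∫ x, φ x • g (x + toTorus (t • v)) v := by
    intro t
    rw [← integral_add_right_eq_self (fun x => φ (x - toTorus (t • v)) • g x v) (toTorus (t • v))]
    simp
  have e5 : ∫ x, (φ (x - toTorus v) - φ x) • f x =
      ∫ x, φ x • ∫ t, g (x + toTorus (t • v)) v ∂μ := by
    calc _ = ∫ x, -∫ t, D (x - toTorus (t • v)) • f x ∂μ := by
          refine integral_congr_ae (Eventually.of_forall fun x => ?_)
          simp only [e2, neg_smul, integral_smul_const]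
      _ = -∫ t, ∫ x, D (x - toTorus (t • v)) • f x ∂volume ∂μ := by
          rw [integral_neg, integral_integral_swap (hb D hf)]
      _ = ∫ t, ∫ x, φ x • g (x + toTorus (t • v)) v ∂volume ∂μ := by
          rw [← integral_neg]
          refine integral_congr_ae (Eventually.of_forall fun t => ?_)
          simp only [e3, neg_neg, e4]
      _ = ∫ x, ∫ t, φ x • g (x + toTorus (t • v)) v ∂μ := by
          rw [integral_integral_swap]
          refine Integrable.swap (f := fun z : Torus d × ℝ =>
            φ z.1 • g (z.1 + toTorus (z.2 • v)) v) ?_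
          exact hG.bdd_smul ‖φ‖ (φ.continuous.comp continuous_fst).aestronglyMeasurable
            (Eventually.of_forall fun x => φ.norm_coe_le_norm _)
      _ = _ := by simp_rw [integral_smul]
  simp_rw [smul_sub (φ _) (f _ - f _)]
  rw [integral_sub (hsm φ (k := fun x => f (x + toTorus v) - f x) (hfv.sub hf)) (hsm φ hGi),
    sub_eq_zero]
  rw [e1, e5]

end WeakGradient

/-! ### Morrey's inequality with the maximal function at one point. -/

section Morrey

variable {d : ℕ}

lemma setLIntegral_closedBall_comp_smul_le {u : Vec d → ℝ≥0∞} (hu : Measurable u) {t ρ : ℝ}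
    (ht : 0 < t) (ht1 : t ≤ 1) :
    ∫⁻ h in closedBall (0 : Vec d) ρ, u (t • h) ≤
      ENNReal.ofReal ((t ^ d)⁻¹) * ∫⁻ h in closedBall (0 : Vec d) ρ, u h := by
  have h1 : ∫⁻ h : Vec d, (closedBall (0 : Vec d) ρ).indicator u (t • h) =
      ENNReal.ofReal ((t ^ d)⁻¹) * ∫⁻ h in closedBall (0 : Vec d) ρ, u h := by
    rw [← lintegral_indicator measurableSet_closedBall,
      ← lintegral_map (f := (closedBall (0 : Vec d) ρ).indicator u)
        (hu.indicator measurableSet_closedBall) (measurable_const_smul t),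
      Measure.map_addHaar_smul _ ht.ne', lintegral_smul_measure, finrank_euclideanSpace_fin,
      abs_of_pos (by positivity), smul_eq_mul]
  rw [← h1, ← lintegral_indicator measurableSet_closedBall]
  refine lintegral_mono fun h => ?_
  by_cases hh : h ∈ closedBall (0 : Vec d) ρ
  · have h2 : t • h ∈ closedBall (0 : Vec d) ρ := by
      rw [mem_closedBall_zero_iff] at *
      rw [norm_smul, Real.norm_of_nonneg ht.le]
      exact (mul_le_of_le_one_left (norm_nonneg _) ht1).trans hh
    simp [hh, h2]
  · simp [hh]

lemma setLIntegral_le_measure_rpow_mul {α : Type*} [MeasurableSpace α] {μ : Measure α} {q : ℝ}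
    (hq : 1 < q) {u : α → ℝ≥0∞} (hu : AEMeasurable u μ) (s : Set α) :
    ∫⁻ x in s, u x ∂μ ≤ μ s ^ (1 - 1 / q) * (∫⁻ x in s, u x ^ q ∂μ) ^ (1 / q) := by
  have hc := Real.HolderConjugate.conjExponent hq
  have h := ENNReal.lintegral_mul_le_Lp_mul_Lq (μ.restrict s) hc hu.restrict
    (aemeasurable_const (b := (1 : ℝ≥0∞)))
  have h1 : 1 / q.conjExponent = 1 - 1 / q := by
    rw [one_div, one_div]; linarith [hc.inv_add_inv_eq_one]
  simp only [Pi.mul_apply, mul_one, ENNReal.one_rpow, setLIntegral_const, one_mul, h1] at h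
  rw [mul_comm]
  exact h

lemma lintegral_rpow_neg_unit {e : ℝ} (he : e < 1) :
    ∫⁻ t in Ioc (0 : ℝ) 1, ENNReal.ofReal (t ^ (-e)) = ENNReal.ofReal (1 / (1 - e)) := by
  have hi : IntervalIntegrable (fun t : ℝ => t ^ (-e)) volume 0 1 :=
    intervalIntegral.intervalIntegrable_rpow' (by linarith)
  rw [← ofReal_integral_eq_lintegral_ofReal, ← intervalIntegral.integral_of_le zero_le_one,
    integral_rpow (Or.inl (by linarith)), Real.one_rpow, Real.zero_rpow (by linarith)]
  · congr 2 <;> ring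
  · exact (intervalIntegrable_iff_integrableOn_Ioc_of_le zero_le_one).1 hi
  · filter_upwards [ae_restrict_mem measurableSet_Ioc] with t ht
    exact Real.rpow_nonneg ht.1.le _

/-- The increments of `f` at `x` are bounded by the integrals of `u` over the segments issued
from `x`. -/
def SegmentBound (f : Torus d → Vec d) (u : Torus d → ℝ≥0∞) (x : Torus d) : Prop :=
  ∀ᵐ h : Vec d, ‖f x - f (x + toTorus h)‖ₑ ≤
    ‖h‖ₑ * ∫⁻ t in Ioc (0 : ℝ) 1, u (x + toTorus (t • h))

/-- The identity along segments holds off a null set of `x` that depends on the direction `h`; joint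
measurability lets Fubini exchange the two quantifiers. -/
lemma HasWeakGradient.ae_segmentBound {f : Torus d → Vec d} {g : Torus d → Vec d →L[ℝ] Vec d}
    (hfg : HasWeakGradient f g) (hf : Integrable f) (hg : Integrable g) (hfm : Measurable f)
    {u : Torus d → ℝ≥0∞} (hu : Measurable u) (hgu : ∀ x, ‖g x‖ₑ ≤ u x) :
    ∀ᵐ x, SegmentBound f u x := by
  unfold SegmentBound
  rw [Measure.ae_ae_comm]
  · refine Eventually.of_forall fun h => ?_
    filter_upwards [hfg.ae_sub_eq_integral hf hg h] with x hx
    rw [← enorm_neg, neg_sub, hx, ← lintegral_const_mul _ (by fun_prop)]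
    refine (enorm_integral_le_lintegral_enorm _).trans (lintegral_mono fun t => ?_)
    refine (ContinuousLinearMap.le_opENorm _ _).trans ?_
    rw [mul_comm]
    gcongr
    exact hgu _
  · refine measurableSet_le (by fun_prop) (Measurable.mul (by fun_prop) ?_)
    exact Measurable.lintegral_prod_right'
      (f := fun z : (Torus d × Vec d) × ℝ => u (z.1.1 + toTorus (z.2 • z.1.2))) (by fun_prop)

/-- After exchanging the integrals, Hölder on the ball followed by the dilation `h ↦ t • h` costs
`t^(-d)` to the power `1/q`. The factor `t^(-d/q)` is integrable on `(0,1]` precisely because `q >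
d`. -/
lemma SegmentBound.setLIntegral_le {q : ℝ} (hq1 : 1 < q) (hq : (d : ℝ) < q)
    {f : Torus d → Vec d} {u : Torus d → ℝ≥0∞} (hu : Measurable u) {x : Torus d}
    (hx : SegmentBound f u x) {ρ : ℝ} :
    ∫⁻ h in closedBall (0 : Vec d) ρ, ‖f x - f (x + toTorus h)‖ₑ ≤
      ENNReal.ofReal (1 / (1 - d / q)) * (ENNReal.ofReal ρ *
      (volume (closedBall (0 : Vec d) ρ) ^ (1 - 1 / q) *
        (∫⁻ w in closedBall (0 : Vec d) ρ, u (x + toTorus w) ^ q) ^ (1 / q))) := by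
  have hq0 : 0 < q := by linarith
  set V := volume (closedBall (0 : Vec d) ρ)
  set I := ∫⁻ w in closedBall (0 : Vec d) ρ, u (x + toTorus w) ^ q
  have hum : Measurable fun z : Vec d × ℝ => u (x + toTorus (z.2 • z.1)) := by fun_prop
  calc _ ≤ ∫⁻ h in closedBall (0 : Vec d) ρ, ENNReal.ofReal ρ *
        ∫⁻ t in Ioc (0 : ℝ) 1, u (x + toTorus (t • h)) := by
        refine setLIntegral_mono_ae' measurableSet_closedBall ?_
        filter_upwards [hx] with h hh hhρ
        refine hh.trans ?_
        gcongr
        rw [← ofReal_norm]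
        exact ENNReal.ofReal_le_ofReal (mem_closedBall_zero_iff.1 hhρ)
    _ = ENNReal.ofReal ρ * ∫⁻ t in Ioc (0 : ℝ) 1, ∫⁻ h in closedBall (0 : Vec d) ρ,
          u (x + toTorus (t • h)) := by
        rw [lintegral_const_mul _ hum.lintegral_prod_right',
          lintegral_lintegral_swap hum.aemeasurable]
    _ ≤ ENNReal.ofReal ρ * ∫⁻ t in Ioc (0 : ℝ) 1,
          ENNReal.ofReal (t ^ (-(d / q))) * (V ^ (1 - 1 / q) * I ^ (1 / q)) := by
        refine mul_le_mul_right (setLIntegral_mono' measurableSet_Ioc fun t ht => ?_) _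
        have ht0 := ht.1
        have hm : Measurable fun w : Vec d => u (x + toTorus w) ^ q := by fun_prop
        calc _ ≤ V ^ (1 - 1 / q) *
              (∫⁻ h in closedBall (0 : Vec d) ρ, u (x + toTorus (t • h)) ^ q) ^ (1 / q) :=
              setLIntegral_le_measure_rpow_mul hq1 (Measurable.aemeasurable (by fun_prop)) _
          _ ≤ V ^ (1 - 1 / q) * (ENNReal.ofReal ((t ^ d)⁻¹) * I) ^ (1 / q) := by
              gcongr
              exact setLIntegral_closedBall_comp_smul_le hm ht.1 ht.2
          _ = _ := by
              rw [ENNReal.mul_rpow_of_nonneg _ _ (by positivity),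
                ENNReal.ofReal_rpow_of_nonneg (by positivity) (by positivity)]
              have : ((t ^ d)⁻¹) ^ (1 / q) = t ^ (-(d / q)) := by
                rw [← Real.rpow_natCast, ← Real.rpow_neg ht0.le, ← Real.rpow_mul ht0.le]
                congr 1; ring
              rw [this]; ring
    _ = _ := by
        rw [lintegral_mul_const _ (by fun_prop), lintegral_rpow_neg_unit
          ((div_lt_one hq0).2 hq)]
        ring

/-- Morrey's estimate, with the average of `u ^ q` over a ball around the first point only. -/
lemma SegmentBound.enorm_sub_le_of_norm_le {q : ℝ} (hq1 : 1 < q) (hq : (d : ℝ) < q)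
    {f : Torus d → Vec d} {u : Torus d → ℝ≥0∞} (hf : Measurable f) (hu : Measurable u)
    {x : Torus d} (hx : SegmentBound f u x) {h : Vec d} (hy : SegmentBound f u (x + toTorus h))
    {ρ : ℝ} (hρ : 0 < ρ) (hh : ‖h‖ ≤ ρ) :
    ‖f x - f (x + toTorus h)‖ₑ ≤ ENNReal.ofReal (1 / (1 - d / q) * (3 * 3 ^ d) * ρ) *
      ((volume (closedBall (0 : Vec d) (3 * ρ)))⁻¹ *
        ∫⁻ w in closedBall (0 : Vec d) (3 * ρ), u (x + toTorus w) ^ q) ^ (1 / q) := by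
  have hq0 : 0 < q := by linarith
  have hdq : 0 < 1 - d / q := sub_pos.2 ((div_lt_one hq0).2 hq)
  have hq' : 0 ≤ 1 - 1 / q := sub_nonneg.2 ((div_le_one hq0).2 hq1.le)
  set K := ENNReal.ofReal (1 / (1 - d / q)) with hK
  set V := volume (closedBall (0 : Vec d) (3 * ρ)) with hV
  set I := ∫⁻ w in closedBall (0 : Vec d) (3 * ρ), u (x + toTorus w) ^ q with hI
  set y := x + toTorus h with hydef
  have hV0 : V ≠ 0 := volume_closedBall_ne_zero (by positivity) _
  have hVt : V ≠ ⊤ := volume_closedBall_ne_top _ _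
  have hV1 : V = ENNReal.ofReal (3 ^ d) * volume (closedBall (0 : Vec d) ρ) :=
    volume_closedBall_mul hρ.le (by norm_num) _ _
  have shift : ∀ F : Vec d → ℝ≥0∞, ∀ a, ∫⁻ w in closedBall (0 : Vec d) (2 * a), F (h + w) =
      ∫⁻ z in closedBall h (2 * a), F z := fun F a => setLIntegral_closedBall_add F h _
  have b1 : ∫⁻ z in closedBall (0 : Vec d) ρ, ‖f x - f (x + toTorus z)‖ₑ ≤
      K * (ENNReal.ofReal ρ * (V ^ (1 - 1 / q) * I ^ (1 / q))) := by
    refine (hx.setLIntegral_le hq1 hq hu).trans ?_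
    have : closedBall (0 : Vec d) ρ ⊆ closedBall 0 (3 * ρ) :=
      closedBall_subset_closedBall (by linarith)
    have hv := measure_mono (μ := volume) this
    have hi := lintegral_mono_set (μ := volume) (f := fun w => u (x + toTorus w) ^ q) this
    gcongr
  -- The ball of radius `ρ` at `x` lies in the ball of radius `2ρ` at `y`, which lies in the ball of
  -- radius `3ρ` at `x`. Hence even the increments issued from `y` are controlled by an average
  -- centred at `x`.
  have b2 : ∫⁻ z in closedBall (0 : Vec d) ρ, ‖f y - f (x + toTorus z)‖ₑ ≤
      K * (ENNReal.ofReal (2 * ρ) * (V ^ (1 - 1 / q) * I ^ (1 / q))) := by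
    calc _ ≤ ∫⁻ z in closedBall h (2 * ρ), ‖f y - f (x + toTorus z)‖ₑ := by
          refine lintegral_mono_set (closedBall_subset_closedBall' ?_)
          rw [dist_zero_left]; linarith
      _ = ∫⁻ w in closedBall (0 : Vec d) (2 * ρ), ‖f y - f (y + toTorus w)‖ₑ := by
          rw [← shift]
          simp only [hydef, toTorus_add, add_assoc]
      _ ≤ _ := hy.setLIntegral_le hq1 hq hu
      _ ≤ _ := by
          have h1 : ∫⁻ w in closedBall (0 : Vec d) (2 * ρ), u (y + toTorus w) ^ q ≤ I := by
            have h2 := shift (fun z => u (x + toTorus z) ^ q) ρ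
            simp only [toTorus_add, ← add_assoc] at h2
            rw [h2]
            refine lintegral_mono_set (closedBall_subset_closedBall' ?_)
            rw [dist_zero_right]; linarith
          have : closedBall (0 : Vec d) (2 * ρ) ⊆ closedBall 0 (3 * ρ) :=
            closedBall_subset_closedBall (by linarith)
          have hv := measure_mono (μ := volume) this
          gcongr
  have hsum : volume (closedBall (0 : Vec d) ρ) * ‖f x - f y‖ₑ ≤
      K * (ENNReal.ofReal (3 * ρ) * (V ^ (1 - 1 / q) * I ^ (1 / q))) := by
    calc _ = ∫⁻ z in closedBall (0 : Vec d) ρ, ‖f x - f y‖ₑ := by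
          rw [setLIntegral_const, mul_comm]
      _ ≤ ∫⁻ z in closedBall (0 : Vec d) ρ,
          (‖f x - f (x + toTorus z)‖ₑ + ‖f y - f (x + toTorus z)‖ₑ) := by
          refine lintegral_mono fun z => ?_
          rw [← sub_sub_sub_cancel_right (f x) (f y) (f (x + toTorus z))]
          exact enorm_sub_le
      _ ≤ K * (ENNReal.ofReal ρ * (V ^ (1 - 1 / q) * I ^ (1 / q))) +
          K * (ENNReal.ofReal (2 * ρ) * (V ^ (1 - 1 / q) * I ^ (1 / q))) := by
          rw [lintegral_add_left (by fun_prop)]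
          exact add_le_add b1 b2
      _ = _ := by
          rw [← mul_add, ← add_mul, ← ENNReal.ofReal_add hρ.le (by positivity)]
          congr 3; ring
  have hVI : V ^ (1 - 1 / q) * I ^ (1 / q) = V * (V⁻¹ * I) ^ (1 / q) := by
    rw [ENNReal.mul_rpow_of_nonneg _ _ (by positivity), ← mul_assoc, ENNReal.inv_rpow,
      ← ENNReal.rpow_neg]
    conv_rhs => rw [← ENNReal.rpow_one V, ← ENNReal.rpow_mul, one_mul,
      ← ENNReal.rpow_add _ _ hV0 hVt]
    rfl
  rw [hVI, hV1] at hsum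
  have h0 := volume_closedBall_ne_zero hρ (0 : Vec d)
  have ht := volume_closedBall_ne_top ρ (0 : Vec d)
  rw [← hV1] at hsum
  rw [← ENNReal.mul_le_mul_iff_right h0 ht]
  refine hsum.trans (le_of_eq ?_)
  generalize (V⁻¹ * I) ^ (1 / q) = X
  rw [hV1, hK, mul_assoc _ (3 * 3 ^ d : ℝ), ENNReal.ofReal_mul (p := 1 / (1 - d / q)) (by positivity),
    show 3 * (3 : ℝ) ^ d * ρ = 3 ^ d * (3 * ρ) by ring, ENNReal.ofReal_mul (p := 3 ^ d) (by positivity)]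
  ring

/-- The dyadic radii `3 (d + 1) 2⁻ᵏ`. -/
noncomputable def dyadicRadius (d k : ℕ) : ℝ := 3 * ((d + 1) * (1 / 2) ^ k)

lemma dyadicRadius_pos (d k : ℕ) : 0 < dyadicRadius d k := by unfold dyadicRadius; positivity

lemma dyadicRadius_le (d k : ℕ) : dyadicRadius d k ≤ 3 * (d + 1) := by
  unfold dyadicRadius
  have : (1 / 2 : ℝ) ^ k ≤ 1 := pow_le_one₀ (by norm_num) (by norm_num)
  have hd : (0 : ℝ) ≤ d + 1 := by positivity
  nlinarith

lemma torusNorm_le_add_one (z : Torus d) : torusNorm z ≤ d + 1 := by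
  have h1 : ∑ i, ‖z i‖ ^ 2 ≤ (d : ℝ) := by
    calc _ ≤ ∑ _i : Fin d, (1 : ℝ) := Finset.sum_le_sum fun i _ => by
          have := AddCircle.norm_le_half_period (1 : ℝ) one_ne_zero (x := z i)
          rw [abs_one] at this
          nlinarith [norm_nonneg (z i)]
      _ = d := by simp
  refine Real.sqrt_le_iff.2 ⟨by positivity, ?_⟩
  nlinarith [(Nat.cast_nonneg d : (0 : ℝ) ≤ d)]

/-- Morrey's estimate with the maximal function at the first point. -/
lemma HasWeakGradient.ae_ae_enorm_sub_le {q : ℝ} (hq1 : 1 < q) (hq : (d : ℝ) < q)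
    {f : Torus d → Vec d} {g : Torus d → Vec d →L[ℝ] Vec d}
    (hfg : HasWeakGradient f g) (hf : Integrable f) (hg : Integrable g) (hfm : Measurable f)
    {u : Torus d → ℝ≥0∞} (hu : Measurable u) (hgu : ∀ x, ‖g x‖ₑ ≤ u x) :
    ∀ᵐ x, ∀ᵐ y, ‖f x - f y‖ₑ ≤ ENNReal.ofReal (1 / (1 - d / q) * (6 * 3 ^ d)) *
      ENNReal.ofReal (torusNorm (x - y)) *
        torusMaximal (dyadicRadius d) (fun x => u x ^ q) x ^ (1 / q) := by
  have hq0 : 0 < q := by linarith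
  have hdq : 0 < 1 - d / q := sub_pos.2 ((div_lt_one hq0).2 hq)
  have hS := hfg.ae_segmentBound hf hg hfm hu hgu
  have hS2 := Measure.ae_ae_of_ae_prod (quasiMeasurePreserving_add_toTorus.ae hS)
  filter_upwards [hS, hS2] with x hx hx2
  have h1 : ∀ᵐ z : Torus d, ‖f x - f (x + z)‖ₑ ≤
      ENNReal.ofReal (1 / (1 - d / q) * (6 * 3 ^ d)) * ENNReal.ofReal (torusNorm z) *
        torusMaximal (dyadicRadius d) (fun x => u x ^ q) x ^ (1 / q) := by
    filter_upwards [ae_exists_shortest_lift hx2] with z hz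
    obtain ⟨h, rfl, hn, hh⟩ := hz
    have hle : ‖h‖ ≤ d + 1 := hn ▸ torusNorm_le_add_one _
    rcases eq_or_ne h 0 with rfl | hne
    · simp [toTorus_zero]
    have hpos : 0 < ‖h‖ := norm_pos_iff.2 hne
    -- The dyadic `ρ = (d + 1) 2⁻ᵏ` satisfies `ρ / 2 < ‖h‖ ≤ ρ`; replacing `ρ` by `2‖h‖` turns the
    -- constant 3 into 6.
    obtain ⟨k, hk1, hk2⟩ := exists_nat_pow_near_of_lt_one (x := ‖h‖ / (d + 1)) (y := 1 / 2)
      (by positivity) ((div_le_one (by positivity)).2 hle) (by norm_num) (by norm_num)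
    rw [lt_div_iff₀ (by positivity), pow_succ] at hk1
    rw [div_le_iff₀ (by positivity)] at hk2
    have hb := hx.enorm_sub_le_of_norm_le hq1 hq hfm hu hh (ρ := (d + 1) * (1 / 2) ^ k) (by positivity)
      (by linarith)
    refine hb.trans ?_
    rw [← ENNReal.ofReal_mul (by positivity)]
    gcongr ?_ * ?_ ^ (1 / q)
    · refine ENNReal.ofReal_le_ofReal ?_
      rw [← hn]
      have : 0 ≤ 1 / (1 - d / q) * (3 * 3 ^ d) := by positivity
      nlinarith
    · exact le_iSup (fun k => (volume (closedBall (0 : Vec d) (dyadicRadius d k)))⁻¹ *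
        ∫⁻ w in closedBall (0 : Vec d) (dyadicRadius d k), u (x + toTorus w) ^ q) k
  have h2 := (measurePreserving_add_left volume (-x)).quasiMeasurePreserving.ae h1
  filter_upwards [h2] with y hy
  rwa [add_neg_cancel_left, ← torusNorm_neg (-x + y), neg_add, neg_neg, ← sub_eq_add_neg] at hy

end Morrey

/-! ### Absolutely continuous curves and logarithmic Gronwall. -/

section Curves

lemma AbsolutelyContinuousOnInterval.of_dist_le {X Y : Type*} [PseudoMetricSpace X]
    [PseudoMetricSpace Y] {f : ℝ → X} {g : ℝ → Y} {a b K : ℝ}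
    (hf : AbsolutelyContinuousOnInterval f a b)
    (h : ∀ x ∈ uIcc a b, ∀ y ∈ uIcc a b, dist (g x) (g y) ≤ K * dist (f x) (f y)) :
    AbsolutelyContinuousOnInterval g a b := by
  have h0 : Tendsto (fun _ : ℕ × (ℕ → ℝ × ℝ) => (0 : ℝ))
    (AbsolutelyContinuousOnInterval.totalLengthFilter ⊓
      𝓟 (AbsolutelyContinuousOnInterval.disjWithin a b)) (𝓝 0) := tendsto_const_nhds
  have h1 := Tendsto.const_mul K hf
  rw [mul_zero] at h1
  refine tendsto_of_tendsto_of_tendsto_of_le_of_le' h0 h1 ?_ ?_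
  · exact Eventually.of_forall fun E => Finset.sum_nonneg fun _ _ => dist_nonneg
  · filter_upwards [mem_inf_of_right (mem_principal_self _)] with E hE
    rw [Finset.mul_sum]
    exact Finset.sum_le_sum fun i hi => h _ (hE.1 i hi).1 _ (hE.1 i hi).2

/-- Fundamental theorem of calculus for an absolutely continuous curve with bounded derivative. -/
lemma AbsolutelyContinuousOnInterval.eq_add_integral {E : Type*} [NormedAddCommGroup E]
    [NormedSpace ℝ E] [FiniteDimensional ℝ E] {c w : ℝ → E} {T B : ℝ} (hT : 0 < T)
    (hc : AbsolutelyContinuousOnInterval c 0 T)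
    (hw : ∀ᵐ t ∂(volume.restrict (Ioc 0 T)), HasDerivAt c (w t) t)
    (hB : ∀ᵐ t ∂(volume.restrict (Ioc 0 T)), ‖w t‖ ≤ B) :
    IntervalIntegrable w volume 0 T ∧ ∀ t ∈ Icc 0 T, c t = c 0 + ∫ s in (0)..t, w s := by
  have := FiniteDimensional.complete ℝ E
  borelize E
  have := FiniteDimensional.proper_real E
  have hm : AEStronglyMeasurable w (volume.restrict (Ioc 0 T)) := by
    refine AEStronglyMeasurable.congr (stronglyMeasurable_deriv c).aestronglyMeasurable ?_
    filter_upwards [hw] with t ht using ht.deriv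
  have hi : IntervalIntegrable w volume 0 T := by
    rw [intervalIntegrable_iff_integrableOn_Ioc_of_le hT.le]
    exact ⟨hm, HasFiniteIntegral.of_bounded hB⟩
  have hB0 : 0 ≤ max B 0 := le_max_right _ _
  have hsub : ∀ x ∈ uIcc 0 T, ∀ y ∈ uIcc 0 T, uIoc x y ⊆ Ioc 0 T := by
    intro x hx y hy
    rw [uIcc_of_le hT.le] at hx hy
    exact Ioc_subset_Ioc (le_min hx.1 hy.1) (max_le hx.2 hy.2)
  have hii : ∀ x ∈ uIcc 0 T, ∀ y ∈ uIcc 0 T, IntervalIntegrable w volume x y := fun x hx y hy =>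
    hi.mono_set (uIcc_subset_uIcc hx hy)
  have h0 : (0 : ℝ) ∈ uIcc 0 T := left_mem_uIcc
  have hac : AbsolutelyContinuousOnInterval (fun t => ∫ s in (0)..t, w s) 0 T := by
    refine LipschitzOnWith.absolutelyContinuousOnInterval (K := (max B 0).toNNReal) ?_
    refine LipschitzOnWith.of_dist_le_mul fun x hx y hy => ?_
    rw [dist_comm, dist_eq_norm, intervalIntegral.integral_interval_sub_left (hii _ h0 _ hy)
      (hii _ h0 _ hx), Real.coe_toNNReal _ hB0, dist_comm, Real.dist_eq]
    refine intervalIntegral.norm_integral_le_of_norm_le_const_ae ?_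
    rw [ae_restrict_iff' measurableSet_Ioc] at hB
    filter_upwards [hB] with t ht htx using (ht (hsub x hx y hy htx)).trans (le_max_left _ _)
  have hz : ∀ᵐ t, t ∈ uIcc 0 T → HasDerivAt (c - fun t => ∫ s in (0)..t, w s) 0 t := by
    rw [ae_restrict_iff' measurableSet_Ioc] at hw
    have hne : ∀ᵐ t : ℝ, t ≠ 0 := by simp [ae_iff]
    filter_upwards [hw, hi.ae_hasDerivAt_integral, hne] with t h1 h2 h3 ht
    have ht' := ht
    rw [uIcc_of_le hT.le] at ht'
    have := (h1 ⟨lt_of_le_of_ne ht'.1 (Ne.symm h3), ht'.2⟩).sub (h2 ht 0 h0)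
    rwa [sub_self] at this
  obtain ⟨C, hC⟩ := (hc.sub hac).const_of_ae_hasDerivAt_zero hz
  refine ⟨hi, fun t ht => ?_⟩
  have h1 := hC 0 h0
  have h2 := hC t (by rwa [uIcc_of_le hT.le])
  simp only [Pi.sub_apply, intervalIntegral.integral_same, sub_zero] at h1 h2
  rw [h1, ← h2, sub_add_cancel]

/-- A logarithmic Gronwall inequality with an integrable coefficient. -/
lemma log_one_add_norm_integral_div_le {E : Type*} [NormedAddCommGroup E] [NormedSpace ℝ E]
    {β : ℝ → E} {T e : ℝ} {α : ℝ → ℝ≥0∞} (hT : 0 < T) (he : 0 < e)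
    (hβ : IntervalIntegrable β volume 0 T) (hα : AEMeasurable α (volume.restrict (Ioc 0 T)))
    (hαfin : ∫⁻ s in Ioc 0 T, α s ≠ ⊤)
    (h : ∀ᵐ s ∂(volume.restrict (Ioc 0 T)),
      ‖β s‖ₑ ≤ α s * ENNReal.ofReal (‖∫ r in (0)..s, β r‖ + e))
    {t : ℝ} (ht : t ∈ Icc 0 T) :
    Real.log (1 + ‖∫ r in (0)..t, β r‖ / e) ≤ (∫⁻ s in Ioc 0 T, α s).toReal := by
  set v : ℝ → E := fun t => ∫ r in (0)..t, β r with hv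
  set a : ℝ → ℝ := fun s => (α s).toReal with ha
  have hai : IntervalIntegrable a volume 0 T := by
    rw [intervalIntegrable_iff_integrableOn_Ioc_of_le hT.le]
    exact integrable_toReal_of_lintegral_ne_top hα hαfin
  have hvc : ContinuousOn v (uIcc 0 T) :=
    intervalIntegral.continuousOn_primitive_interval' hβ left_mem_uIcc
  set k : ℝ → ℝ := fun s => a s * (‖v s‖ + e) with hk
  have hki : IntervalIntegrable k volume 0 T :=
    hai.mul_continuousOn (hvc.norm.add continuousOn_const)
  have hk0 : ∀ s, 0 ≤ k s := fun s => by positivity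
  have hmem : ∀ s, s ∈ uIcc 0 T ↔ s ∈ Icc 0 T := fun s => by rw [uIcc_of_le hT.le]
  have hki' : ∀ s ∈ Icc 0 T, IntervalIntegrable k volume 0 s := fun s hs =>
    hki.mono_set (uIcc_subset_uIcc left_mem_uIcc ((hmem s).2 hs))
  -- `F` dominates `‖v‖ + e` and has derivative `a (‖v‖ + e) ≤ a F` almost everywhere, so `log F`
  -- has derivative at most `a`. Since `F ≥ e`, where the logarithm is Lipschitz, `log F` is
  -- absolutely continuous and this can be integrated.
  set F : ℝ → ℝ := fun t => e + ∫ s in (0)..t, k s with hF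
  have hFe : ∀ s ∈ Icc 0 T, e ≤ F s := fun s hs =>
    le_add_of_nonneg_right (intervalIntegral.integral_nonneg hs.1 fun r _ => hk0 r)
  have hβk : ∀ᵐ s ∂(volume.restrict (Ioc 0 T)), ‖β s‖ ≤ k s := by
    filter_upwards [h, ae_lt_top' hα hαfin] with s hs hsf
    have h1 : ‖β s‖ₑ ≤ ENNReal.ofReal (k s) := by
      rw [hk, ENNReal.ofReal_mul ENNReal.toReal_nonneg, ENNReal.ofReal_toReal hsf.ne]
      exact hs
    rw [← ofReal_norm] at h1
    exact (ENNReal.ofReal_le_ofReal_iff (hk0 s)).1 h1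
  have hvF : ∀ s ∈ Icc 0 T, ‖v s‖ + e ≤ F s := by
    intro s hs
    rw [add_comm]
    refine add_le_add le_rfl ?_
    refine intervalIntegral.norm_integral_le_of_norm_le hs.1 ?_ (hki' s hs)
    rw [ae_restrict_iff' measurableSet_Ioc] at hβk
    filter_upwards [hβk] with r hr hrs using hr ⟨hrs.1, hrs.2.trans hs.2⟩
  have hFac : AbsolutelyContinuousOnInterval F 0 T :=
    (hki.absolutelyContinuousOnInterval_intervalIntegral left_mem_uIcc).of_dist_le (K := 1)
      fun x _ y _ => by simp [hF]
  have hlog : ∀ x y : ℝ, e ≤ x → e ≤ y → Real.log x - Real.log y ≤ e⁻¹ * |x - y| := by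
    intro x y hx hy
    have hx0 := he.trans_le hx
    have hy0 := he.trans_le hy
    rw [← Real.log_div hx0.ne' hy0.ne']
    calc _ ≤ x / y - 1 := Real.log_le_sub_one_of_pos (by positivity)
      _ = y⁻¹ * (x - y) := by field_simp
      _ ≤ y⁻¹ * |x - y| := by gcongr; exact le_abs_self _
      _ ≤ e⁻¹ * |x - y| := by gcongr
  have hGac : AbsolutelyContinuousOnInterval (fun s => Real.log (F s)) 0 T := by
    refine hFac.of_dist_le (K := e⁻¹) fun x hx y hy => ?_
    have hx' := hFe x ((hmem x).1 hx)
    have hy' := hFe y ((hmem y).1 hy)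
    rw [Real.dist_eq, Real.dist_eq, abs_le']
    refine ⟨hlog _ _ hx' hy', ?_⟩
    rw [neg_sub, abs_sub_comm]
    exact hlog _ _ hy' hx'
  have hGt : AbsolutelyContinuousOnInterval (fun s => Real.log (F s)) 0 t :=
    hGac.mono (uIcc_subset_uIcc left_mem_uIcc ((hmem t).2 ht))
  have hait : IntervalIntegrable a volume 0 t :=
    hai.mono_set (uIcc_subset_uIcc left_mem_uIcc ((hmem t).2 ht))
  have hder : ∀ᵐ s, s ∈ Icc 0 t → deriv (fun s => Real.log (F s)) s ≤ a s := by
    filter_upwards [hki.ae_hasDerivAt_integral] with s hs hst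
    have hsT : s ∈ Icc 0 T := ⟨hst.1, hst.2.trans ht.2⟩
    have h1 : HasDerivAt F (k s) s := (hs ((hmem s).2 hsT) 0 left_mem_uIcc).const_add e
    have hpos := he.trans_le (hFe s hsT)
    rw [(h1.log hpos.ne').deriv, div_le_iff₀ hpos]
    exact mul_le_mul_of_nonneg_left (hvF s hsT) ENNReal.toReal_nonneg
  have hint : Real.log (F t) - Real.log (F 0) ≤ ∫ s in (0)..t, a s := by
    rw [← hGt.integral_deriv_eq_sub]
    refine intervalIntegral.integral_mono_ae_restrict ht.1 hGt.intervalIntegrable_deriv hait ?_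
    rw [EventuallyLE, ae_restrict_iff' measurableSet_Icc]
    exact hder
  have hF0 : F 0 = e := by simp [hF]
  have hle : ∫ s in (0)..t, a s ≤ (∫⁻ s in Ioc 0 T, α s).toReal := by
    rw [← integral_toReal hα (ae_lt_top' hα hαfin), intervalIntegral.integral_of_le ht.1]
    refine setIntegral_mono_set ?_ (Eventually.of_forall fun s => ENNReal.toReal_nonneg)
      (Ioc_subset_Ioc_right ht.2).eventuallyLE
    exact integrable_toReal_of_lintegral_ne_top hα hαfin
  rw [hF0] at hint
  have h3 : Real.log (1 + ‖v t‖ / e) ≤ Real.log (F t) - Real.log e := by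
    rw [← Real.log_div (he.trans_le (hFe t ht)).ne' he.ne']
    refine Real.log_le_log (by positivity) ?_
    rw [le_div_iff₀ he, add_mul, one_mul, div_mul_cancel₀ _ he.ne', add_comm]
    exact hvF t ht
  linarith

end Curves

/-! ### Measurability of the flow and integral bounds along it. -/

section Flow

variable {d : ℕ}

lemma exists_measurableSet_of_ae {α : Type*} [MeasurableSpace α] {μ : Measure α} {P : α → Prop}
    (h : ∀ᵐ x ∂μ, P x) : ∃ G : Set α, (∀ x ∈ G, P x) ∧ MeasurableSet G ∧ ∀ᵐ x ∂μ, x ∈ G := by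
  refine ⟨(toMeasurable μ {x | ¬ P x})ᶜ, fun x hx => ?_, (measurableSet_toMeasurable _ _).compl, ?_⟩
  · by_contra hP
    exact hx (subset_toMeasurable _ _ hP)
  · refine measure_eq_zero_iff_ae_notMem.1 ?_
    rw [measure_toMeasurable]
    exact h

lemma IsACSolution.continuousOn {T : ℝ} (hT : 0 < T) {b : ℝ → Torus d → Vec d} {x : Torus d}
    {γ : ℝ → Torus d} (h : IsACSolution T b x γ) : ContinuousOn γ (Icc 0 T) := by
  obtain ⟨-, c, hc, hγ, -⟩ := h
  have h1 := hc.continuousOn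
  rw [uIcc_of_le hT.le] at h1
  exact (continuous_toTorus.comp_continuousOn h1).congr fun t ht => (hγ t ht).symm

/-- A regular Lagrangian flow has a jointly measurable version. -/
lemma IsRegularLagrangianFlow.exists_measurable {T : ℝ} (hT : 0 < T) {b : ℝ → Torus d → Vec d}
    {L : ℝ≥0} {Φ : ℝ → Torus d → Torus d} (hΦ : IsRegularLagrangianFlow T b L Φ) :
    ∃ Ψ : ℝ → Torus d → Torus d, Measurable (Function.uncurry Ψ) ∧
      (∀ᵐ x, ∀ t ∈ Icc 0 T, Ψ t x = Φ t x) ∧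
      ∀ t ∈ Icc 0 T, Measure.map (Ψ t) volume ≤ L • (volume : Measure (Torus d)) := by
  -- Clamping time to `[0,T]` makes the trajectories continuous on all of `ℝ`. Joint measurability
  -- then follows from measurability at each time, obtained as a limit along rational times.
  set τ : ℝ → ℝ := fun t => projIcc 0 T hT.le t with hτ
  have hτc : Continuous τ := continuous_subtype_val.comp continuous_projIcc
  have hτm : ∀ t, τ t ∈ Icc 0 T := fun t => (projIcc 0 T hT.le t).2
  have hτe : ∀ t ∈ Icc 0 T, τ t = t := fun t ht => by simp only [hτ, projIcc_of_mem hT.le ht]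
  have hmk : ∀ q : ℚ, AEMeasurable (Φ (τ q)) volume := fun q => hΦ.aemeasurable _ (hτm _)
  have hgood : ∀ᵐ x, ContinuousOn (fun t => Φ t x) (Icc 0 T) ∧
      ∀ q : ℚ, Φ (τ q) x = (hmk q).mk _ x := by
    filter_upwards [hΦ.solution, ae_all_iff.2 fun q : ℚ => (hmk q).ae_eq_mk] with x hx hq
    exact ⟨hx.continuousOn hT, hq⟩
  obtain ⟨G, hGsub, hGm, hG0⟩ := exists_measurableSet_of_ae hgood
  classical
  set Ψ : ℝ → Torus d → Torus d := fun t x => if x ∈ G then Φ (τ t) x else x with hΨ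
  have hcont : ∀ x, Continuous fun t => Ψ t x := by
    intro x
    by_cases hx : x ∈ G
    · simp only [hΨ, hx, if_true]
      exact (hGsub x hx).1.comp_continuous hτc hτm
    · simp only [hΨ, hx, if_false]
      exact continuous_const
  have hmeas : ∀ t, Measurable (Ψ t) := by
    intro t
    have hden : ∃ q : ℕ → ℚ, Tendsto (fun n => ((q n : ℚ) : ℝ)) atTop (𝓝 t) := by
      have h1 : t ∈ closure (range ((↑) : ℚ → ℝ)) := Rat.denseRange_cast t
      obtain ⟨y, hy, hyt⟩ := mem_closure_iff_seq_limit.1 h1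
      choose q hq using hy
      exact ⟨q, by simpa only [hq] using hyt⟩
    obtain ⟨q, hq⟩ := hden
    refine measurable_of_tendsto_metrizable (f := fun n x => if x ∈ G then (hmk (q n)).mk _ x else x)
      (fun n => Measurable.ite hGm (hmk (q n)).measurable_mk measurable_id) ?_
    rw [tendsto_pi_nhds]
    intro x
    have h2 := ((hcont x).tendsto t).comp hq
    refine h2.congr fun n => ?_
    by_cases hx : x ∈ G
    · simp only [Function.comp_apply, hΨ, hx, if_true, (hGsub x hx).2]
    · simp only [Function.comp_apply, hΨ, hx, if_false]
  have heq : ∀ᵐ x, ∀ t ∈ Icc 0 T, Ψ t x = Φ t x := by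
    filter_upwards [hG0] with x hx t ht
    simp only [hΨ, hx, if_true, hτe t ht]
  refine ⟨Ψ, measurable_uncurry_of_continuous_of_measurable hcont hmeas, heq, fun t ht => ?_⟩
  rw [Measure.map_congr (g := Φ t) (by filter_upwards [heq] with x hx using hx t ht)]
  exact hΦ.compressibility t ht

lemma lintegral_comp_le_of_map_le {L : ℝ≥0} {ψ : Torus d → Torus d} (hψ : Measurable ψ)
    (hL : Measure.map ψ volume ≤ L • (volume : Measure (Torus d))) {f : Torus d → ℝ≥0∞}
    (hf : Measurable f) : ∫⁻ x, f (ψ x) ≤ L * ∫⁻ x, f x := by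
  rw [← lintegral_map hf hψ]
  refine (lintegral_mono' hL le_rfl).trans (le_of_eq ?_)
  rw [lintegral_smul_measure]
  rfl

/-- Along a flow with bounded compression, almost every trajectory avoids a given null set of
space-time at almost every time. -/
lemma ae_ae_flow_of_ae_spaceTime {T : ℝ} {L : ℝ≥0} {Ψ : ℝ → Torus d → Torus d}
    (hΨ : Measurable (Function.uncurry Ψ))
    (hL : ∀ t ∈ Icc 0 T, Measure.map (Ψ t) volume ≤ L • (volume : Measure (Torus d)))
    {P : ℝ × Torus d → Prop} (hP : ∀ᵐ z ∂(spaceTime d T), P z) :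
    ∀ᵐ x, ∀ᵐ s ∂(volume.restrict (Ioc 0 T)), P (s, Ψ s x) := by
  obtain ⟨G, hGsub, hGm, hG0⟩ := exists_measurableSet_of_ae hP
  have hm : Measurable fun z : Torus d × ℝ => (z.2, Ψ z.2 z.1) :=
    measurable_snd.prodMk (hΨ.comp measurable_swap)
  have h1 : ∀ᵐ x, ∀ᵐ s ∂(volume.restrict (Ioc 0 T)), (s, Ψ s x) ∈ G := by
    rw [Measure.ae_ae_comm (p := fun x s => (s, Ψ s x) ∈ G) (hm hGm)]
    filter_upwards [Measure.ae_ae_of_ae_prod hG0, ae_restrict_mem measurableSet_Ioc] with s hs hsT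
    have hac : Measure.map (Ψ s) volume ≪ volume :=
      (Measure.absolutelyContinuous_of_le (hL s (Ioc_subset_Icc_self hsT))).trans
        (Measure.smul_absolutelyContinuous)
    exact ae_of_ae_map (hΨ.comp measurable_prodMk_left).aemeasurable (hac.ae_le hs)
  filter_upwards [h1] with x hx
  filter_upwards [hx] with s hs using hGsub _ hs

/-- A form of Minkowski's integral inequality. -/
lemma lintegral_lintegral_rpow_le {S X : Type*} [MeasurableSpace S] [MeasurableSpace X]
    {μ : Measure S} {ν : Measure X} [SFinite μ] [SFinite ν] {p : ℝ} (hp : 1 < p)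
    {g : S → X → ℝ≥0∞} (hg : Measurable (Function.uncurry g)) {w : S → ℝ≥0∞} (hw : Measurable w)
    (hw0 : ∀ s, w s ≠ 0) (hwt : ∫⁻ s, w s ∂μ ≠ ⊤) {A : ℝ≥0∞}
    (h : ∀ᵐ s ∂μ, ∫⁻ x, g s x ^ p ∂ν ≤ A * w s ^ p) :
    ∫⁻ x, (∫⁻ s, g s x ∂μ) ^ p ∂ν ≤ A * (∫⁻ s, w s ∂μ) ^ p := by
  have hp0 : 0 < p := by linarith
  have hp1 : 0 < p - 1 := by linarith
  have hc := Real.HolderConjugate.conjExponent hp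
  have hpp : p.conjExponent = p / (p - 1) := rfl
  -- Hölder is applied to `g = (g w^(-e)) w^e`; this exponent makes the second factor integrate to
  -- `∫ w` and leaves the weight `w^(-(p-1))` on `g^p`, which the hypothesis turns into `A w`.
  set e : ℝ := (p - 1) / p with he
  have he0 : 0 < e := by positivity
  set W := ∫⁻ s, w s ∂μ with hW
  have hwae : ∀ᵐ s ∂μ, w s < ⊤ := ae_lt_top hw hwt
  have hgx : ∀ x, Measurable fun s => g s x := fun x => hg.comp (measurable_prodMk_right (y := x))
  have hgm : Measurable fun z : X × S => g z.2 z.1 := hg.comp measurable_swap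
  have hx : ∀ x, (∫⁻ s, g s x ∂μ) ^ p ≤ W ^ (p - 1) * ∫⁻ s, g s x ^ p * w s ^ (-(p - 1)) ∂μ := by
    intro x
    have h1 : ∫⁻ s, g s x ∂μ ≤ (∫⁻ s, (g s x * w s ^ (-e)) ^ p ∂μ) ^ (1 / p) *
        (∫⁻ s, (w s ^ e) ^ p.conjExponent ∂μ) ^ (1 / p.conjExponent) := by
      refine le_trans (le_of_eq ?_) (ENNReal.lintegral_mul_le_Lp_mul_Lq μ hc
        (f := fun s => g s x * w s ^ (-e)) (g := fun s => w s ^ e)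
        (((hgx x).mul (hw.pow_const _)).aemeasurable) ((hw.pow_const _).aemeasurable))
      refine lintegral_congr_ae ?_
      filter_upwards [hwae] with s hs
      rw [Pi.mul_apply, mul_assoc, ← ENNReal.rpow_add _ _ (hw0 s) hs.ne, neg_add_cancel,
        ENNReal.rpow_zero, mul_one]
    have h2 : ∀ s, (w s ^ e) ^ p.conjExponent = w s := by
      intro s
      rw [← ENNReal.rpow_mul, hpp, he, show (p - 1) / p * (p / (p - 1)) = 1 by field_simp,
        ENNReal.rpow_one]
    have h3 : ∀ s, (g s x * w s ^ (-e)) ^ p = g s x ^ p * w s ^ (-(p - 1)) := by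
      intro s
      rw [ENNReal.mul_rpow_of_nonneg _ _ hp0.le, ← ENNReal.rpow_mul, he]
      congr 2; field_simp
    simp_rw [h2, h3] at h1
    calc _ ≤ _ := ENNReal.rpow_le_rpow h1 hp0.le
      _ = _ := by
        rw [ENNReal.mul_rpow_of_nonneg _ _ hp0.le, ← ENNReal.rpow_mul, ← ENNReal.rpow_mul,
          one_div_mul_cancel hp0.ne', ENNReal.rpow_one, mul_comm]
        congr 2
        rw [hpp]; field_simp
  have hM : Measurable fun z : X × S => g z.2 z.1 ^ p * w z.2 ^ (-(p - 1)) := by fun_prop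
  calc _ ≤ ∫⁻ x, W ^ (p - 1) * ∫⁻ s, g s x ^ p * w s ^ (-(p - 1)) ∂μ ∂ν := lintegral_mono hx
    _ = W ^ (p - 1) * ∫⁻ s, ∫⁻ x, g s x ^ p * w s ^ (-(p - 1)) ∂ν ∂μ := by
        rw [lintegral_const_mul _ hM.lintegral_prod_right', lintegral_lintegral_swap hM.aemeasurable]
    _ ≤ W ^ (p - 1) * ∫⁻ s, A * w s ∂μ := by
        refine mul_le_mul_right (lintegral_mono_ae ?_) _
        filter_upwards [h, hwae] with s hs hst
        have hms : Measurable fun x => g s x ^ p :=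
          (hg.comp (measurable_prodMk_left (x := s))).pow_const p
        rw [lintegral_mul_const _ hms]
        calc _ ≤ A * w s ^ p * w s ^ (-(p - 1)) := by gcongr
          _ = A * w s := by
            rw [mul_assoc, ← ENNReal.rpow_add _ _ (hw0 s) hst.ne,
              show p + -(p - 1) = 1 by ring, ENNReal.rpow_one]
    _ = A * W ^ p := by
        rw [lintegral_const_mul _ hw, ← hW, mul_left_comm]
        congr 1
        conv_lhs => rw [← ENNReal.rpow_one W, ← ENNReal.rpow_mul, one_mul]
        rw [← ENNReal.rpow_add_of_nonneg _ _ hp1.le zero_le_one, sub_add_cancel]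

/-- The maximal function of the `q`-th power, renormalized, of a function on space-time. -/
noncomputable def flowMaximal (q : ℝ) (U : ℝ → Torus d → ℝ≥0∞) (s : ℝ) (x : Torus d) : ℝ≥0∞ :=
  torusMaximal (dyadicRadius d) (fun x => U s x ^ q) x ^ (1 / q)

lemma measurable_flowMaximal {q : ℝ} {U : ℝ → Torus d → ℝ≥0∞}
    (hU : Measurable (Function.uncurry U)) :
    Measurable (Function.uncurry (flowMaximal q U)) := by
  refine Measurable.pow_const ?_ _
  refine Measurable.iSup fun k => Measurable.const_mul ?_ _
  refine Measurable.lintegral_prod_right'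
    (f := fun z : (ℝ × Torus d) × Vec d => U z.1.1 (z.1.2 + toTorus z.2) ^ q) ?_
  have h1 : Measurable fun z : (ℝ × Torus d) × Vec d => (z.1.1, z.1.2 + toTorus z.2) := by fun_prop
  exact (hU.comp h1).pow_const q

/-- The `Lᵖ` bound for the time integral of the maximal function along the flow. -/
lemma lintegral_flowMaximal_rpow_le {T p q : ℝ} (hT : 0 < T) (hq : 1 < q) (hqp : q < p)
    {L K : ℝ≥0} {Ψ : ℝ → Torus d → Torus d} (hΨ : Measurable (Function.uncurry Ψ))
    (hL : ∀ t ∈ Icc 0 T, Measure.map (Ψ t) volume ≤ L • (volume : Measure (Torus d)))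
    {U : ℝ → Torus d → ℝ≥0∞} (hU : Measurable (Function.uncurry U))
    (hK : ∫⁻ s in Ioc 0 T, (∫⁻ x, U s x ^ p) ^ (1 / p) ≤ K) :
    ∫⁻ x, (∫⁻ s in Ioc 0 T, flowMaximal q U s (Ψ s x)) ^ p ≤
      L * ENNReal.ofReal (2 ^ (p / q) * 4 ^ d * ((p / q) / (p / q - 1)) *
        (1 + 3 * (d + 1)) ^ d) * (K + 1 : ℝ≥0∞) ^ p := by
  have hq0 : 0 < q := by linarith
  have hp1 : 1 < p := hq.trans hqp
  have hp0 : 0 < p := by linarith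
  set C : ℝ≥0∞ := ENNReal.ofReal (2 ^ (p / q) * 4 ^ d * ((p / q) / (p / q - 1)) *
        (1 + 3 * (d + 1)) ^ d) with hC
  have hUs : ∀ s, Measurable (U s) := fun s => hU.comp (measurable_prodMk_left (x := s))
  have hmax := measurable_flowMaximal (q := q) hU
  have hmaxs : ∀ s, Measurable (flowMaximal q U s) := fun s =>
    hmax.comp (measurable_prodMk_left (x := s))
  -- The added `1 / T` keeps the weight nonzero and contributes exactly 1 to its integral over
  -- `(0,T]`, so the final bound does not depend on `T`.
  set w : ℝ → ℝ≥0∞ := fun s => (∫⁻ x, U s x ^ p) ^ (1 / p) + ENNReal.ofReal (1 / T) with hw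
  have hwm : Measurable w := by
    refine Measurable.add (Measurable.pow_const ?_ _) measurable_const
    exact (hU.pow_const p).lintegral_prod_right'
  have hwint : ∫⁻ s in Ioc 0 T, w s ≤ K + 1 := by
    rw [lintegral_add_right _ measurable_const, setLIntegral_const, Real.volume_Ioc, sub_zero,
      ← ENNReal.ofReal_mul (by positivity), one_div_mul_cancel hT.ne', ENNReal.ofReal_one]
    gcongr
  refine (lintegral_lintegral_rpow_le hp1 (A := L * C) (w := w)
    (g := fun s x => flowMaximal q U s (Ψ s x)) ?_ hwm ?_ ?_ ?_).trans ?_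
  · exact hmax.comp (measurable_fst.prodMk hΨ)
  · intro s
    have : 0 < ENNReal.ofReal (1 / T) := ENNReal.ofReal_pos.2 (by positivity)
    exact (this.trans_le le_add_self).ne'
  · exact (hwint.trans_lt (by simp)).ne
  · filter_upwards [ae_restrict_mem measurableSet_Ioc] with s hs
    calc _ ≤ L * ∫⁻ x, flowMaximal q U s x ^ p :=
          lintegral_comp_le_of_map_le (hΨ.comp (measurable_prodMk_left (x := s)))
            (hL s (Ioc_subset_Icc_self hs)) ((hmaxs s).pow_const p)
      _ = L * ∫⁻ x, torusMaximal (dyadicRadius d) (fun x => U s x ^ q) x ^ (p / q) := by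
          simp_rw [flowMaximal, ← ENNReal.rpow_mul, one_div_mul_eq_div]
      _ ≤ L * (C * ∫⁻ x, (U s x ^ q) ^ (p / q)) := by
          gcongr
          exact lintegral_torusMaximal_rpow_le ((one_lt_div hq0).2 hqp) (dyadicRadius_pos d)
            (dyadicRadius_le d) ((hUs s).pow_const q)
      _ = L * C * ((∫⁻ x, U s x ^ p) ^ (1 / p)) ^ p := by
          simp_rw [← ENNReal.rpow_mul, mul_div_cancel₀ p hq0.ne']
          rw [one_div_mul_cancel hp0.ne', ENNReal.rpow_one, mul_assoc]
      _ ≤ _ := by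
          gcongr
          exact le_self_add
  · gcongr

end Flow

/-! ### The asymmetric Lipschitz estimate in space-time. -/

section Velocity

variable {d : ℕ}

lemma HasWeakGradient.congr {f f' : Torus d → Vec d} {g g' : Torus d → Vec d →L[ℝ] Vec d}
    (h : HasWeakGradient f g) (hf : f =ᵐ[volume] f') (hg : g =ᵐ[volume] g') :
    HasWeakGradient f' g' := by
  intro φ hφ v
  have h1 : ∫ x, deriv (fun s : ℝ => φ (x + toTorus (s • v))) 0 • f' x =
      ∫ x, deriv (fun s : ℝ => φ (x + toTorus (s • v))) 0 • f x := by
    refine integral_congr_ae ?_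
    filter_upwards [hf] with x hx
    rw [hx]
  have h2 : ∫ x, φ x • g' x v = ∫ x, φ x • g x v := by
    refine integral_congr_ae ?_
    filter_upwards [hg] with x hx
    rw [hx]
  rw [h1, h2]
  exact h φ hφ v

/-- The constant in Morrey's estimate. -/
noncomputable def morreyConst (d : ℕ) (q : ℝ) : ℝ := 1 / (1 - d / q) * (6 * 3 ^ d)

lemma morreyConst_nonneg {q : ℝ} (hq0 : 0 < q) (hq : (d : ℝ) < q) : 0 ≤ morreyConst d q := by
  have hdq : 0 < 1 - d / q := sub_pos.2 ((div_lt_one hq0).2 hq)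
  unfold morreyConst
  positivity

lemma ae_spaceTime_norm_le {T : ℝ} {b : ℝ → Torus d → Vec d}
    {B : ℝ≥0} (hB : eLpNorm (Function.uncurry b) ⊤ (spaceTime d T) ≤ B) :
    ∀ᵐ z ∂(spaceTime d T), ‖b z.1 z.2‖ ≤ B := by
  rw [eLpNorm_exponent_top] at hB
  filter_upwards [ae_le_eLpNormEssSup (f := Function.uncurry b) (μ := spaceTime d T)] with z hz
  have h1 := hz.trans hB
  rw [← ofReal_norm, ← ENNReal.ofReal_coe_nnreal] at h1
  exact (ENNReal.ofReal_le_ofReal_iff B.2).1 h1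

/-- The asymmetric Lipschitz estimate for an admissible velocity field, almost everywhere in
space-time. -/
lemma IsAdmissibleVelocity.exists_lipschitz_majorant {T p q : ℝ} (hq1 : 1 < q) (hq : (d : ℝ) < q)
    (hp : 1 < p) {b : ℝ → Torus d → Vec d} {Db : ℝ → Torus d → Vec d →L[ℝ] Vec d}
    (hb : IsAdmissibleVelocity T p b Db) {B K : ℝ≥0}
    (hB : ∀ᵐ z ∂(spaceTime d T), ‖b z.1 z.2‖ ≤ B)
    (hK : ∫⁻ t in Ioc 0 T, eLpNorm (Db t) (ENNReal.ofReal p) volume ≤ K) :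
    ∃ U : ℝ → Torus d → ℝ≥0∞, Measurable (Function.uncurry U) ∧
      ∫⁻ s in Ioc 0 T, (∫⁻ x, U s x ^ p) ^ (1 / p) ≤ K ∧
      ∀ᵐ z ∂(spaceTime d T), ∀ᵐ y, ‖b z.1 z.2 - b z.1 y‖ₑ ≤
        ENNReal.ofReal (morreyConst d q) * ENNReal.ofReal (torusNorm (z.2 - y)) *
          flowMaximal q U z.1 z.2 := by
  have hp0 : 0 < p := by linarith
  -- Jointly measurable versions are needed so that the majorant is measurable and the estimate,
  -- proved for almost every fixed time, becomes a statement almost everywhere in space-time.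
  obtain ⟨b', hb', hbb⟩ := hb.memLp_top.1
  obtain ⟨g', hgm, hgg⟩ := hb.aestronglyMeasurable_grad
  have hbm : Measurable b' := hb'.measurable
  replace hbb : ∀ᵐ z ∂(spaceTime d T), b z.1 z.2 = b' z := hbb
  replace hgg : ∀ᵐ z ∂(spaceTime d T), Db z.1 z.2 = g' z := hgg
  have hbb2 := Measure.ae_ae_of_ae_prod hbb
  have hgg2 := Measure.ae_ae_of_ae_prod hgg
  set U : ℝ → Torus d → ℝ≥0∞ := fun s x => ‖g' (s, x)‖ₑ with hU
  have hUm : Measurable (Function.uncurry U) := hgm.enorm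
  have hnorm : ∀ s, (∀ᵐ x, Db s x = g' (s, x)) →
      (∫⁻ x, U s x ^ p) ^ (1 / p) = eLpNorm (Db s) (ENNReal.ofReal p) volume := by
    intro s hs
    rw [eLpNorm_eq_lintegral_rpow_enorm_toReal (ENNReal.ofReal_pos.2 hp0).ne' ENNReal.ofReal_ne_top,
      ENNReal.toReal_ofReal hp0.le]
    congr 1
    refine lintegral_congr_ae ?_
    filter_upwards [hs] with x hx
    rw [hx]
  refine ⟨U, hUm, ?_, ?_⟩
  · refine le_trans (le_of_eq (lintegral_congr_ae ?_)) hK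
    filter_upwards [hgg2] with s hs using hnorm s hs
  set P : ℝ × Torus d → Torus d → Prop := fun z y => ‖b' z - b' (z.1, y)‖ₑ ≤
        ENNReal.ofReal (morreyConst d q) * ENNReal.ofReal (torusNorm (z.2 - y)) *
          flowMaximal q U z.1 z.2 with hP
  have hPm : MeasurableSet {z : (ℝ × Torus d) × Torus d | P z.1 z.2} := by
    have hmax : Measurable fun z : (ℝ × Torus d) × Torus d => flowMaximal q U z.1.1 z.1.2 :=
      (measurable_flowMaximal hUm).comp measurable_fst
    have h1 : Measurable fun z : (ℝ × Torus d) × Torus d => torusNorm (z.1.2 - z.2) :=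
      continuous_torusNorm.measurable.comp (by fun_prop)
    refine measurableSet_le ?_ ((measurable_const.mul h1.ennreal_ofReal).mul hmax)
    exact ((hbm.comp measurable_fst).sub (hbm.comp (by fun_prop))).enorm
  have hPae : MeasurableSet {z : ℝ × Torus d | ∀ᵐ y, P z y} :=
    measurable_measure_prodMk_left hPm.compl (measurableSet_singleton 0)
  have hKfin : ∀ᵐ s ∂(volume.restrict (Ioc 0 T)), (∫⁻ x, U s x ^ p) ^ (1 / p) < ⊤ := by
    have h1 : Measurable fun s => (∫⁻ x, U s x ^ p) ^ (1 / p) :=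
      ((hUm.pow_const p).lintegral_prod_right').pow_const _
    refine ae_lt_top h1 (ne_top_of_le_ne_top (ENNReal.coe_ne_top (r := K)) ?_)
    refine le_trans (le_of_eq (lintegral_congr_ae ?_)) hK
    filter_upwards [hgg2] with s hs using hnorm s hs
  have hmain : ∀ᵐ z ∂(spaceTime d T), ∀ᵐ y, P z y := by
    rw [spaceTime, Measure.ae_prod_iff_ae_ae hPae]
    filter_upwards [hbb2, hgg2, hb.hasWeakGradient, Measure.ae_ae_of_ae_prod hB, hKfin]
      with s h1 h2 h3 h4 h5
    have hbs : Measurable fun x => b' (s, x) := hbm.comp measurable_prodMk_left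
    have hgs : StronglyMeasurable fun x => g' (s, x) := hgm.comp_measurable measurable_prodMk_left
    have hbi : Integrable fun x => b' (s, x) := by
      refine ⟨hbs.aestronglyMeasurable, HasFiniteIntegral.of_bounded (C := B) ?_⟩
      filter_upwards [h1, h4] with x hx hx4
      rw [← hx]
      exact hx4
    have hgi : Integrable fun x => g' (s, x) := by
      have h6 : MemLp (fun x => g' (s, x)) (ENNReal.ofReal p) volume := by
        refine ⟨hgs.aestronglyMeasurable, ?_⟩
        rw [eLpNorm_eq_lintegral_rpow_enorm_toReal (ENNReal.ofReal_pos.2 hp0).ne'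
          ENNReal.ofReal_ne_top, ENNReal.toReal_ofReal hp0.le]
        exact h5
      exact h6.integrable (ENNReal.one_le_ofReal.2 hp.le)
    have hUs : Measurable (U s) := hgs.enorm
    have h7 : HasWeakGradient (fun x => b' (s, x)) fun x => g' (s, x) := h3.congr h1 h2
    have h8 := h7.ae_ae_enorm_sub_le hq1 hq hbi hgi hbs hUs (fun x => le_rfl)
    exact h8
  have hfst : ∀ᵐ z ∂(spaceTime d T), ∀ᵐ y, b z.1 y = b' (z.1, y) :=
    Measure.quasiMeasurePreserving_fst.ae hbb2
  filter_upwards [hmain, hbb, hfst] with z hz h1 h2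
  filter_upwards [hz, h2] with y hy hy2
  rw [h1, hy2]
  exact hy

end Velocity

/-! ### The cell-averaged scheme along one trajectory. -/

section Scheme

variable {d : ℕ}

/-- Closed balls are closed and convex, hence contain averages of functions with values in them.
This converts a bound at almost every point of a cell into a bound for the cell average. -/
lemma enorm_sub_setAverage_le {α E : Type*} [MeasurableSpace α] [NormedAddCommGroup E]
    [NormedSpace ℝ E] [CompleteSpace E] {μ : Measure α} {s : Set α} (h0 : μ s ≠ 0) (ht : μ s ≠ ⊤)
    {f : α → E} (hf : IntegrableOn f s μ) {a : E} {m : ℝ≥0∞}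
    (h : ∀ᵐ y ∂(μ.restrict s), ‖a - f y‖ₑ ≤ m) : ‖a - ⨍ y in s, f y ∂μ‖ₑ ≤ m := by
  rcases eq_or_ne m ⊤ with rfl | hm
  · exact le_top
  lift m to ℝ≥0 using hm
  have h1 : ⨍ y in s, f y ∂μ ∈ Metric.closedBall a m := by
    refine (convex_closedBall a (m : ℝ)).set_average_mem Metric.isClosed_closedBall h0 ht ?_ hf
    filter_upwards [h] with y hy
    rw [Metric.mem_closedBall, dist_comm, dist_eq_norm]
    exact_mod_cast hy
  rw [Metric.mem_closedBall, dist_comm, dist_eq_norm] at h1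
  exact_mod_cast h1

/-- The displacement of the points of the cell `Q` after `n` steps of the cell-averaged Euler
scheme. -/
noncomputable def eulerDisplacement (b : ℝ → Torus d → Vec d) (Δt : ℝ) (Q : Set (Torus d))
    (x₀ : Torus d) (n : ℕ) : Vec d :=
  ∑ m ∈ Finset.range n, Δt • meanVelocity b Δt Q x₀ (meanEulerNode b Δt Q x₀ m x₀) m

/-- The velocity of the cell `Q` averaged in space only. -/
noncomputable def cellVelocity (b : ℝ → Torus d → Vec d) (Δt : ℝ) (Q : Set (Torus d))
    (x₀ : Torus d) (s : ℝ) : Vec d :=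
  ⨍ y in Q, b s (meanEulerNode b Δt Q x₀ ⌊s / Δt⌋₊ x₀ + y - x₀)

/-- The velocity of a step depends only on the orbit of `x₀`, so the whole cell moves by one rigid
translation. -/
lemma meanEulerNode_eq (b : ℝ → Torus d → Vec d) (Δt : ℝ) (Q : Set (Torus d)) (x₀ x : Torus d)
    (n : ℕ) : meanEulerNode b Δt Q x₀ n x = x + toTorus (eulerDisplacement b Δt Q x₀ n) := by
  induction n with
  | zero => simp [meanEulerNode, eulerDisplacement, toTorus_zero]
  | succ n ih =>
    rw [meanEulerNode, ih, eulerDisplacement, eulerDisplacement, Finset.sum_range_succ,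
      toTorus_add, add_assoc]

variable {T Δt : ℝ} {b : ℝ → Torus d → Vec d} {B : ℝ≥0} {Q : Set (Torus d)} {x₀ : Torus d} {M : ℕ}

lemma measurePreserving_add_sub (a x₀ : Torus d) :
    MeasurePreserving (fun y : Torus d => a + y - x₀) volume volume :=
  (measurePreserving_sub_right volume x₀).comp (measurePreserving_add_left volume a)

/-- One null set of times serves all translations `a` at once, which matters because the node used
at time `s` depends on `s`. -/
lemma ae_integrableOn_translate (hbm : AEStronglyMeasurable (Function.uncurry b) (spaceTime d T))
    (hB : ∀ᵐ z ∂(spaceTime d T), ‖b z.1 z.2‖ ≤ B) :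
    ∀ᵐ s ∂(volume.restrict (Ioc 0 T)), ∀ a : Torus d,
      IntegrableOn (fun y => b s (a + y - x₀)) Q := by
  filter_upwards [hbm.prodMk_left, Measure.ae_ae_of_ae_prod hB] with s h1 h2 a
  have h3 : Integrable (b s) := ⟨h1, HasFiniteIntegral.of_bounded h2⟩
  exact ((measurePreserving_add_sub a x₀).integrable_comp_of_integrable h3).integrableOn

lemma ae_norm_cellVelocity_le (hbm : AEStronglyMeasurable (Function.uncurry b) (spaceTime d T))
    (hB : ∀ᵐ z ∂(spaceTime d T), ‖b z.1 z.2‖ ≤ B) (hQ : volume Q ≠ 0) :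
    ∀ᵐ s ∂(volume.restrict (Ioc 0 T)), ‖cellVelocity b Δt Q x₀ s‖ ≤ B := by
  filter_upwards [ae_integrableOn_translate (Q := Q) (x₀ := x₀) hbm hB,
    Measure.ae_ae_of_ae_prod hB] with s h1 h2
  set a := meanEulerNode b Δt Q x₀ ⌊s / Δt⌋₊ x₀
  have h3 := enorm_sub_setAverage_le hQ (measure_ne_top _ _) (h1 a) (a := 0) (m := B) (by
    refine ae_restrict_of_ae ?_
    filter_upwards [(measurePreserving_add_sub a x₀).quasiMeasurePreserving.ae h2] with y hy
    rw [zero_sub, enorm_neg]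
    exact_mod_cast hy)
  rw [zero_sub, enorm_neg] at h3
  exact_mod_cast h3

/-- The node is constant on each time step; measurable versions for the countably many step indices
are glued along the floor function. -/
lemma aestronglyMeasurable_cellVelocity
    (hbm : AEStronglyMeasurable (Function.uncurry b) (spaceTime d T)) :
    AEStronglyMeasurable (cellVelocity b Δt Q x₀) (volume.restrict (Ioc 0 T)) := by
  have h1 : ∀ n : ℕ, AEStronglyMeasurable
      (fun s => ⨍ y in Q, b s (meanEulerNode b Δt Q x₀ n x₀ + y - x₀))
      (volume.restrict (Ioc 0 T)) := by
    intro n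
    set a := meanEulerNode b Δt Q x₀ n x₀
    have hmp : MeasurePreserving (fun z : ℝ × Torus d => (z.1, a + z.2 - x₀))
        (spaceTime d T) (spaceTime d T) :=
      (MeasurePreserving.id _).prod (measurePreserving_add_sub a x₀)
    have h2 : AEStronglyMeasurable (fun z : ℝ × Torus d => b z.1 (a + z.2 - x₀))
        ((volume.restrict (Ioc 0 T)).prod (volume.restrict Q)) := by
      refine (hbm.comp_measurePreserving hmp).mono_ac ?_
      exact Measure.AbsolutelyContinuous.rfl.prod Measure.absolutelyContinuous_restrict
    simp_rw [setAverage_eq]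
    have h3 : AEStronglyMeasurable (fun s => ∫ y in Q, b s (a + y - x₀))
        (volume.restrict (Ioc 0 T)) := h2.integral_prod_right'
    exact h3.const_smul (volume.real Q)⁻¹
  choose k hk hke using h1
  have hkm : Measurable fun s : ℝ => k ⌊s / Δt⌋₊ s := by
    have h2 : Measurable fun z : ℕ × ℝ => k z.1 z.2 :=
      measurable_from_prod_countable_right fun n => (hk n).measurable
    exact h2.comp ((Nat.measurable_floor.comp (by fun_prop)).prodMk measurable_id)
  refine ⟨_, hkm.stronglyMeasurable, ?_⟩
  filter_upwards [ae_all_iff.2 hke] with s hs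
  exact hs ⌊s / Δt⌋₊

lemma intervalIntegrable_cellVelocity (hT : 0 ≤ T)
    (hbm : AEStronglyMeasurable (Function.uncurry b) (spaceTime d T))
    (hB : ∀ᵐ z ∂(spaceTime d T), ‖b z.1 z.2‖ ≤ B) (hQ : volume Q ≠ 0) :
    IntervalIntegrable (cellVelocity b Δt Q x₀) volume 0 T := by
  rw [intervalIntegrable_iff_integrableOn_Ioc_of_le hT]
  exact ⟨aestronglyMeasurable_cellVelocity hbm,
    HasFiniteIntegral.of_bounded (ae_norm_cellVelocity_le hbm hB hQ)⟩

lemma norm_integral_le_of_ae_norm_le {E : Type*} [NormedAddCommGroup E] [NormedSpace ℝ E]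
    {w : ℝ → E} {B s t : ℝ} (hw : ∀ᵐ r ∂(volume.restrict (Ioc 0 T)), ‖w r‖ ≤ B)
    (hs : 0 ≤ s) (hst : s ≤ t) (ht : t ≤ T) : ‖∫ r in s..t, w r‖ ≤ B * (t - s) := by
  rw [ae_restrict_iff' measurableSet_Ioc] at hw
  rw [← abs_of_nonneg (sub_nonneg.2 hst)]
  refine intervalIntegral.norm_integral_le_of_norm_le_const_ae ?_
  filter_upwards [hw] with r hr hrs
  rw [uIoc_of_le hst] at hrs
  exact hr ⟨hs.trans_lt hrs.1, hrs.2.trans ht⟩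

lemma integral_cellVelocity_step (hΔt : 0 < Δt) (n : ℕ) :
    ∫ s in (n * Δt)..((n + 1) * Δt), cellVelocity b Δt Q x₀ s =
      Δt • meanVelocity b Δt Q x₀ (meanEulerNode b Δt Q x₀ n x₀) n := by
  rw [meanVelocity, interval_average_eq, smul_smul,
    show Δt * ((n + 1) * Δt - n * Δt)⁻¹ = 1 by field_simp; ring, one_smul]
  refine intervalIntegral.integral_congr_ae ?_
  -- The floor jumps at the right endpoint of the step, so that single time is discarded.
  have hne : ∀ᵐ s : ℝ, s ≠ (n + 1) * Δt := by simp [ae_iff]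
  filter_upwards [hne] with s hs hsI
  rw [uIoc_of_le (by nlinarith)] at hsI
  have hfl : ⌊s / Δt⌋₊ = n := by
    have h1 : 0 ≤ s := le_trans (by positivity) hsI.1.le
    rw [Nat.floor_eq_iff (by positivity), le_div_iff₀ hΔt, div_lt_iff₀ hΔt]
    exact ⟨hsI.1.le, lt_of_le_of_ne hsI.2 hs⟩
  rw [cellVelocity, hfl]

lemma eulerDisplacement_eq_integral (hΔt : 0 < Δt) (hM : M * Δt = T)
    (hi : IntervalIntegrable (cellVelocity b Δt Q x₀) volume 0 T) {n : ℕ} (hn : n ≤ M) :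
    eulerDisplacement b Δt Q x₀ n = ∫ s in (0)..(n * Δt), cellVelocity b Δt Q x₀ s := by
  have hsub : ∀ k : ℕ, k ≤ M → (k * Δt : ℝ) ∈ uIcc 0 T := by
    intro k hk
    have h1 : (k : ℝ) ≤ M := by exact_mod_cast hk
    rw [uIcc_of_le (by rw [← hM]; positivity), ← hM]
    exact ⟨by positivity, by gcongr⟩
  induction n with
  | zero => simp [eulerDisplacement]
  | succ n ih =>
    have h1 := hi.mono_set (uIcc_subset_uIcc left_mem_uIcc (hsub n (by omega)))
    have h2 := hi.mono_set (uIcc_subset_uIcc (hsub n (by omega)) (hsub (n + 1) hn))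
    rw [eulerDisplacement, Finset.sum_range_succ, ← eulerDisplacement, ih (by omega),
      ← integral_cellVelocity_step hΔt]
    push_cast at h2 ⊢
    exact intervalIntegral.integral_add_adjacent_intervals h1 h2

/-- The error of the cell-averaged Euler scheme along one trajectory. -/
lemma exists_trajectory_error_bound {δ Δx C : ℝ} (hT : 0 < T) (hΔt : 0 < Δt) (hM : M * Δt = T)
    (hδ : 0 < δ) (hΔtδ : Δt ≤ δ) (hΔxδ : Δx ≤ δ) (hC : 0 ≤ C)
    (hbm : AEStronglyMeasurable (Function.uncurry b) (spaceTime d T))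
    (hB : ∀ᵐ z ∂(spaceTime d T), ‖b z.1 z.2‖ ≤ B) (hQ : volume Q ≠ 0) (hQm : MeasurableSet Q)
    {x : Torus d} (hdiam : ∀ y ∈ Q, torusNorm (x - y) ≤ Δx)
    {γ : ℝ → Torus d} (hγ : IsACSolution T b x γ)
    (hγB : ∀ᵐ s ∂(volume.restrict (Ioc 0 T)), ‖b s (γ s)‖ ≤ B)
    {N : ℝ → ℝ≥0∞} (hN : AEMeasurable N (volume.restrict (Ioc 0 T)))
    (hNfin : ∫⁻ s in Ioc 0 T, N s ≠ ⊤)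
    (hγN : ∀ᵐ s ∂(volume.restrict (Ioc 0 T)), ∀ᵐ y, ‖b s (γ s) - b s y‖ₑ ≤
      ENNReal.ofReal C * ENNReal.ofReal (torusNorm (γ s - y)) * N s)
    {t : ℝ} (ht : t ∈ Icc 0 T) {n : ℕ} (hn : n = ⌊t / Δt⌋₊) :
    ∃ V : ℝ, 0 ≤ V ∧ Real.log (1 + V / ((B + 1) * δ)) ≤ C * (∫⁻ s in Ioc 0 T, N s).toReal ∧
      torusNorm (γ t - (meanEulerNode b Δt Q x₀ n x + toTorus ((t - n * Δt) •
        meanVelocity b Δt Q x₀ (meanEulerNode b Δt Q x₀ n x₀) n))) ≤ V + 2 * B * δ ∧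
      torusNorm (γ t - (meanEulerNode b Δt Q x₀ n x + toTorus ((t - n * Δt) •
        meanVelocity b Δt Q x₀ (meanEulerNode b Δt Q x₀ n x₀) n))) ≤ 2 * B * t := by
  obtain ⟨hγ0, c, hc, hcγ, hcd⟩ := hγ
  obtain ⟨hbi, hcint⟩ := hc.eq_add_integral hT hcd hγB
  set w := cellVelocity b Δt Q x₀ with hw
  have hwi : IntervalIntegrable w volume 0 T := intervalIntegrable_cellVelocity hT.le hbm hB hQ
  have hwB : ∀ᵐ s ∂(volume.restrict (Ioc 0 T)), ‖w s‖ ≤ B := ae_norm_cellVelocity_le hbm hB hQ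
  have hc0 : toTorus (c 0) = x := (hcγ 0 ⟨le_rfl, hT.le⟩).trans hγ0
  have hB0 : (0 : ℝ) ≤ B := B.2
  have hmem : ∀ s ∈ Icc 0 T, s ∈ uIcc 0 T := fun s hs => by rwa [uIcc_of_le hT.le]
  have hwii : ∀ r ∈ Icc 0 T, ∀ s ∈ Icc 0 T, IntervalIntegrable w volume r s := fun r hr s hs =>
    hwi.mono_set (uIcc_subset_uIcc (hmem r hr) (hmem s hs))
  have h0T : (0 : ℝ) ∈ Icc 0 T := ⟨le_rfl, hT.le⟩
  have hfloor : ∀ s ∈ Icc 0 T, (⌊s / Δt⌋₊ : ℝ) * Δt ≤ s ∧ s - ⌊s / Δt⌋₊ * Δt ≤ Δt ∧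
      ⌊s / Δt⌋₊ ≤ M := by
    intro s hs
    have hs0 : 0 ≤ s / Δt := div_nonneg hs.1 hΔt.le
    refine ⟨(le_div_iff₀ hΔt).1 (Nat.floor_le hs0), ?_, ?_⟩
    · have := (div_lt_iff₀ hΔt).1 (Nat.lt_floor_add_one (s / Δt))
      linarith
    · refine Nat.floor_le_of_le ?_
      rw [div_le_iff₀ hΔt, hM]
      exact hs.2
  have hdisp : ∀ s ∈ Icc 0 T, ‖(∫ r in (0)..s, w r) - eulerDisplacement b Δt Q x₀ ⌊s / Δt⌋₊‖ ≤
      B * Δt := by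
    intro s hs
    obtain ⟨h1, h2, h3⟩ := hfloor s hs
    have h4 : (⌊s / Δt⌋₊ : ℝ) * Δt ∈ Icc 0 T := ⟨by positivity, h1.trans hs.2⟩
    rw [eulerDisplacement_eq_integral hΔt hM hwi h3,
      intervalIntegral.integral_interval_sub_left (hwii _ h0T _ hs) (hwii _ h0T _ h4)]
    exact (norm_integral_le_of_ae_norm_le hwB h4.1 h1 hs.2).trans (by gcongr)
  set v : ℝ → Vec d := fun s => ∫ r in (0)..s, (b r (γ r) - w r) with hv
  have hveq : ∀ s ∈ Icc 0 T, v s = c s - c 0 - ∫ r in (0)..s, w r := by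
    intro s hs
    have h1 := hcint s hs
    simp only [hv]
    rw [intervalIntegral.integral_sub
      (hbi.mono_set (uIcc_subset_uIcc left_mem_uIcc (hmem s hs))) (hwii _ h0T _ hs), h1]
    abel
  -- Besides `‖v s‖`, the distance from the trajectory to a point of the moved cell has two
  -- contributions: the motion since the last node, at most `B * Δt`, and the cell diameter `Δx`.
  -- Together they are at most `(B + 1) * δ`.
  have he : 0 < (B + 1) * δ := by positivity
  have hgron := log_one_add_norm_integral_div_le (β := fun r => b r (γ r) - w r)
    (α := fun s => ENNReal.ofReal C * N s) hT he (hbi.sub hwi) (hN.const_mul _) (by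
      rw [lintegral_const_mul' _ _ ENNReal.ofReal_ne_top]
      exact ENNReal.mul_ne_top ENNReal.ofReal_ne_top hNfin) (by
      filter_upwards [hγN, ae_integrableOn_translate (Q := Q) (x₀ := x₀) hbm hB,
        ae_restrict_mem measurableSet_Ioc] with s h1 h2 hsI
      have hs := Ioc_subset_Icc_self hsI
      set k := ⌊s / Δt⌋₊
      refine enorm_sub_setAverage_le hQ (measure_ne_top _ _) (h2 _) ?_
      -- The translation to the moved cell preserves measure, so the exceptional `y` of the
      -- Lipschitz estimate remain null inside the cell.
      have h3 := (measurePreserving_add_sub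
        (meanEulerNode b Δt Q x₀ k x₀) x₀).quasiMeasurePreserving.ae h1
      filter_upwards [ae_restrict_of_ae h3, ae_restrict_mem hQm] with y hy hyQ
      refine hy.trans ?_
      rw [mul_assoc, mul_assoc, mul_comm (ENNReal.ofReal (torusNorm _))]
      refine mul_le_mul_right (mul_le_mul_right (ENNReal.ofReal_le_ofReal ?_) _) _
      have h4 : γ s - (meanEulerNode b Δt Q x₀ k x₀ + y - x₀) =
          toTorus (v s) + toTorus ((∫ r in (0)..s, w r) - eulerDisplacement b Δt Q x₀ k) +
            (x - y) := by
        rw [← toTorus_add, hveq s hs, ← hcγ s hs, meanEulerNode_eq, ← hc0]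
        simp only [toTorus_add, toTorus_sub]
        abel
      rw [h4]
      calc _ ≤ torusNorm (toTorus (v s)) +
            torusNorm (toTorus ((∫ r in (0)..s, w r) - eulerDisplacement b Δt Q x₀ k)) +
            torusNorm (x - y) :=
            (torusNorm_add_le _ _).trans (add_le_add (torusNorm_add_le _ _) le_rfl)
        _ ≤ ‖v s‖ + B * Δt + Δx := add_le_add (add_le_add (torusNorm_toTorus_le _)
            ((torusNorm_toTorus_le _).trans (hdisp s hs))) (hdiam y hyQ)
        _ ≤ ‖v s‖ + (B + 1) * δ := by nlinarith) ht
  set W := meanVelocity b Δt Q x₀ (meanEulerNode b Δt Q x₀ n x₀) n with hW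
  obtain ⟨hf1, hf2, hf3⟩ := hfloor t ht
  rw [← hn] at hf1 hf2 hf3
  -- When `n = M` the step after `T` lies where `b` is not controlled, but then `t = T = n * Δt` and
  -- the velocity is multiplied by zero.
  have hWn : ‖(t - n * Δt) • W‖ ≤ B * (t - n * Δt) := by
    rcases hf3.lt_or_eq with hlt | heq
    · have h1 := integral_cellVelocity_step (b := b) (Q := Q) (x₀ := x₀) hΔt n
      have hle : ((n : ℝ) + 1) * Δt ≤ T := by
        have : (n : ℝ) + 1 ≤ M := by exact_mod_cast hlt
        rw [← hM]; gcongr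
      have h2 := norm_integral_le_of_ae_norm_le hwB (by positivity : 0 ≤ (n : ℝ) * Δt)
        (by nlinarith : (n : ℝ) * Δt ≤ (n + 1) * Δt) hle
      rw [hw, h1, norm_smul, Real.norm_of_nonneg hΔt.le] at h2
      have h3 : ‖W‖ ≤ B := by
        refine le_of_mul_le_mul_left ?_ hΔt
        linarith
      rw [norm_smul, Real.norm_of_nonneg (by linarith), mul_comm]
      gcongr
    · have : t - n * Δt = 0 := by
        have h1 := ht.2
        rw [heq, hM] at hf1 ⊢
        linarith
      rw [this]
      simp
  have hDn : eulerDisplacement b Δt Q x₀ n = ∫ r in (0)..(n * Δt), w r :=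
    eulerDisplacement_eq_integral hΔt hM hwi hf3
  have herr : γ t - (meanEulerNode b Δt Q x₀ n x + toTorus ((t - n * Δt) • W)) =
      toTorus (c t - c 0 - eulerDisplacement b Δt Q x₀ n - (t - n * Δt) • W) := by
    rw [meanEulerNode_eq, ← hcγ t ht, ← hc0]
    simp only [toTorus_sub]
    abel
  refine ⟨‖v t‖, norm_nonneg _, ?_, ?_, ?_⟩
  · rw [lintegral_const_mul' _ _ ENNReal.ofReal_ne_top, ENNReal.toReal_mul,
      ENNReal.toReal_ofReal hC] at hgron
    exact hgron
  · rw [herr]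
    refine (torusNorm_toTorus_le _).trans ?_
    have h1 : c t - c 0 - eulerDisplacement b Δt Q x₀ n - (t - n * Δt) • W =
        v t + ((∫ r in (0)..t, w r) - eulerDisplacement b Δt Q x₀ n) - (t - n * Δt) • W := by
      rw [hveq t ht]; abel
    have h2 := hdisp t ht
    rw [← hn] at h2
    rw [h1]
    calc _ ≤ ‖v t‖ + B * Δt + B * (t - n * Δt) :=
          (norm_sub_le _ _).trans (add_le_add ((norm_add_le _ _).trans (add_le_add le_rfl h2)) hWn)
      _ ≤ _ := by nlinarith
  · rw [herr]
    refine (torusNorm_toTorus_le _).trans ?_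
    have h1 : ‖c t - c 0‖ ≤ B * t := by
      have := norm_integral_le_of_ae_norm_le hγB le_rfl ht.1 ht.2
      rw [hcint t ht, add_sub_cancel_left]
      simpa using this
    have h2 : ‖eulerDisplacement b Δt Q x₀ n‖ ≤ B * (n * Δt) := by
      rw [hDn]
      simpa using norm_integral_le_of_ae_norm_le hwB le_rfl (by positivity : 0 ≤ (n : ℝ) * Δt)
        (hf1.trans ht.2)
    calc _ ≤ B * t + B * (n * Δt) + B * (t - n * Δt) :=
          (norm_sub_le _ _).trans (add_le_add ((norm_sub_le _ _).trans (add_le_add h1 h2)) hWn)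
      _ = _ := by ring

end Scheme

/-! ### From the logarithmic bound to the rate. -/

section MainEstimate

variable {d : ℕ}

/-- If `r ≤ √δ`, then `r = √r √r ≤ √(2Bt) δ^(1/4)`, and `δ^(1/4) |log δ| ≤ 4`. If `r > √δ`, then
`log(1 + r/δ) ≥ |log δ| / 2`, while the same logarithm is at most `log(2B+1) + H`; multiplying by `r
≤ 2Bt` gives the other term. Using `r ≤ 2Bt` in both cases is what makes the bound vanish as `t →
0`. -/
lemma le_inv_abs_log_mul {r V δ B H t : ℝ} (hr0 : 0 ≤ r) (hr1 : r ≤ 2 * B * t)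
    (hr2 : r ≤ V + 2 * B * δ) (hV : 0 ≤ V) (hB : 0 ≤ B) (ht : 0 ≤ t) (hδ : 0 < δ) (hδ1 : δ < 1)
    (hH : Real.log (1 + V / ((B + 1) * δ)) ≤ H) :
    r ≤ |Real.log δ|⁻¹ * (4 * √(2 * B * t) + 4 * B * t * (Real.log (2 * B + 1) + H)) := by
  have hlog : Real.log δ < 0 := Real.log_neg hδ hδ1
  have hl : 0 < |Real.log δ| := abs_pos.2 hlog.ne
  have hl' : |Real.log δ| = -Real.log δ := abs_of_neg hlog
  have hH0 : 0 ≤ H := (Real.log_nonneg (by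
    have : 0 ≤ V / ((B + 1) * δ) := by positivity
    linarith)).trans hH
  have hlB : 0 ≤ Real.log (2 * B + 1) := Real.log_nonneg (by linarith)
  have hs0 : 0 < √δ := Real.sqrt_pos.2 hδ
  rw [inv_mul_eq_div, le_div_iff₀ hl]
  rcases le_or_gt r (√δ) with hc | hc
  · set y := √(√δ) with hy
    have hy0 : 0 < y := Real.sqrt_pos.2 hs0
    have hyδ : Real.log δ = 4 * Real.log y := by
      have : δ = y ^ 4 := by
        rw [show y ^ 4 = (y ^ 2) ^ 2 by ring, hy, Real.sq_sqrt hs0.le, Real.sq_sqrt hδ.le]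
      rw [this, Real.log_pow]; norm_num
    have h1 : y * |Real.log δ| ≤ 4 := by
      have h2 := Real.log_le_sub_one_of_pos (inv_pos.2 hy0)
      rw [Real.log_inv] at h2
      have h3 : y * (-Real.log y) ≤ y * (y⁻¹ - 1) := mul_le_mul_of_nonneg_left h2 hy0.le
      rw [mul_sub, mul_inv_cancel₀ hy0.ne'] at h3
      rw [hl', hyδ]
      linarith
    have h2 : r ≤ √(2 * B * t) * y := by
      calc r = √r * √r := (Real.mul_self_sqrt hr0).symm
        _ ≤ √(2 * B * t) * y :=
            mul_le_mul (Real.sqrt_le_sqrt hr1) (Real.sqrt_le_sqrt hc) (Real.sqrt_nonneg _)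
              (Real.sqrt_nonneg _)
    calc r * |Real.log δ| ≤ √(2 * B * t) * y * |Real.log δ| := by gcongr
      _ = √(2 * B * t) * (y * |Real.log δ|) := by ring
      _ ≤ √(2 * B * t) * 4 := by gcongr
      _ ≤ _ := by
        have : 0 ≤ 4 * B * t * (Real.log (2 * B + 1) + H) := by positivity
        linarith
  · have h1 : Real.log (1 + r / δ) ≤ Real.log (2 * B + 1) + H := by
      calc _ ≤ Real.log ((2 * B + 1) * (1 + V / ((B + 1) * δ))) := by
            refine Real.log_le_log (by positivity) ?_
            have h2 : r / δ ≤ V / δ + 2 * B := by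
              rw [div_le_iff₀ hδ, add_mul, div_mul_cancel₀ _ hδ.ne']
              exact hr2
            have h3 : V / δ = (B + 1) * (V / ((B + 1) * δ)) := by field_simp
            have h4 : 0 ≤ V / ((B + 1) * δ) := by positivity
            nlinarith
        _ = Real.log (2 * B + 1) + Real.log (1 + V / ((B + 1) * δ)) :=
            Real.log_mul (by positivity) (by positivity)
        _ ≤ _ := by gcongr
    have h2 : |Real.log δ| / 2 ≤ Real.log (1 + r / δ) := by
      have h3 : |Real.log δ| / 2 = Real.log (√δ / δ) := by
        rw [Real.log_div hs0.ne' hδ.ne', Real.log_sqrt hδ.le, hl']; ring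
      rw [h3]
      refine Real.log_le_log (by positivity) ?_
      have : √δ / δ ≤ r / δ := by gcongr
      linarith
    calc r * |Real.log δ| ≤ (2 * B * t) * (2 * (Real.log (2 * B + 1) + H)) := by
          refine mul_le_mul hr1 (by linarith) hl.le (by positivity)
      _ ≤ _ := by
        have : 0 ≤ √(2 * B * t) := Real.sqrt_nonneg _
        linarith

lemma eLpNorm_le_of_enorm_le_const_add_mul {α E : Type*} [MeasurableSpace α] {μ : Measure α}
    [IsProbabilityMeasure μ] [NormedAddCommGroup E] {p : ℝ} (hp : 1 ≤ p) {f : α → E}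
    {J : α → ℝ≥0∞} (hJ : Measurable J) {a₀ a₁ : ℝ≥0∞}
    (h : ∀ᵐ x ∂μ, ‖f x‖ₑ ≤ a₀ + a₁ * J x) :
    eLpNorm f (ENNReal.ofReal p) μ ≤ a₀ + a₁ * (∫⁻ x, J x ^ p ∂μ) ^ (1 / p) := by
  have hp0 : 0 < p := by linarith
  rw [eLpNorm_eq_lintegral_rpow_enorm_toReal (ENNReal.ofReal_pos.2 hp0).ne' ENNReal.ofReal_ne_top,
    ENNReal.toReal_ofReal hp0.le]
  calc _ ≤ (∫⁻ x, (a₀ + a₁ * J x) ^ p ∂μ) ^ (1 / p) := by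
        refine ENNReal.rpow_le_rpow (lintegral_mono_ae ?_) (by positivity)
        filter_upwards [h] with x hx using ENNReal.rpow_le_rpow hx hp0.le
    _ ≤ (∫⁻ _x, a₀ ^ p ∂μ) ^ (1 / p) + (∫⁻ x, (a₁ * J x) ^ p ∂μ) ^ (1 / p) :=
        ENNReal.lintegral_Lp_add_le (f := fun _ => a₀) aemeasurable_const
          (hJ.const_mul _).aemeasurable hp
    _ = _ := by
        simp_rw [ENNReal.mul_rpow_of_nonneg _ _ hp0.le]
        rw [lintegral_const, measure_univ, mul_one, lintegral_const_mul _ (hJ.pow_const p),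
          ENNReal.mul_rpow_of_nonneg _ _ (by positivity), ← ENNReal.rpow_mul, ← ENNReal.rpow_mul,
          mul_one_div_cancel hp0.ne', ENNReal.rpow_one, ENNReal.rpow_one]

/-- The bound of `lintegral_flowMaximal_rpow_le`. -/
noncomputable def flowMaximalBound (d : ℕ) (p q : ℝ) (L K : ℝ≥0) : ℝ≥0∞ :=
  L * ENNReal.ofReal (2 ^ (p / q) * 4 ^ d * ((p / q) / (p / q - 1)) *
    (1 + 3 * (d + 1)) ^ d) * (K + 1 : ℝ≥0∞) ^ p

lemma flowMaximalBound_ne_top (d : ℕ) {p : ℝ} (hp : 0 ≤ p) (q : ℝ) (L K : ℝ≥0) :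
    flowMaximalBound d p q L K ≠ ⊤ :=
  ENNReal.mul_ne_top (ENNReal.mul_ne_top ENNReal.coe_ne_top ENNReal.ofReal_ne_top)
    (ENNReal.rpow_ne_top_of_nonneg hp (by simp))

end MainEstimate

/-! ### The error estimate. -/

theorem mainTheorem6 (d : ℕ) (hd : 1 ≤ d) (p : ℝ) (hp : (d : ℝ) < p) (B K L : ℝ≥0) :
    ∃ C : ℝ → ℝ, Tendsto C (𝓝[>] 0) (𝓝 0) ∧
      ∀ (T : ℝ) (_hT : 0 < T)
        (b : ℝ → Torus d → Vec d) (Db : ℝ → Torus d → Vec d →L[ℝ] Vec d)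
        (_hb : IsAdmissibleVelocity T p b Db)
        (_hB : eLpNorm (Function.uncurry b) ⊤ (spaceTime d T) ≤ B)
        (_hK : ∫⁻ t in Ioc 0 T, eLpNorm (Db t) (ENNReal.ofReal p) volume ≤ K)
        (Φ : ℝ → Torus d → Torus d) (_hΦ : IsRegularLagrangianFlow T b L Φ)
        (M : ℕ) (Δt : ℝ) (_hΔt : 0 < Δt) (_hM : M * Δt = T)
        (N : ℕ) (Q : Fin N → Set (Torus d)) (_hQ : ∀ i, MeasurableSet (Q i))
        (P : IndexedPartition Q) (Δx : ℝ) (_hΔx : 0 < Δx)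
        (_hdiam : ∀ i, ∀ x ∈ Q i, ∀ y ∈ Q i, torusNorm (x - y) ≤ Δx)
        (_hlt : max Δt Δx < 1) (t : ℝ) (_ht : t ∈ Icc 0 T),
        eLpNorm (fun x => torusNorm (Φ t x - meanEulerFlow b Δt P t x))
            (ENNReal.ofReal p) volume ≤
          ENNReal.ofReal (C t * |Real.log (max Δt Δx)|⁻¹) := by
  have hd1 : (1 : ℝ) ≤ d := by exact_mod_cast hd
  set q : ℝ := (d + p) / 2 with hq
  have hdq : (d : ℝ) < q := by rw [hq]; linarith
  have hqp : q < p := by rw [hq]; linarith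
  have hq1 : 1 < q := hd1.trans_lt hdq
  have hp1 : 1 < p := hq1.trans hqp
  have hp0 : 0 < p := by linarith
  set A : ℝ := (flowMaximalBound d p q L K ^ (1 / p)).toReal with hA
  have hAtop : flowMaximalBound d p q L K ^ (1 / p) ≠ ⊤ :=
    ENNReal.rpow_ne_top_of_nonneg (by positivity) (flowMaximalBound_ne_top d hp0.le q L K)
  have hA0 : 0 ≤ A := ENNReal.toReal_nonneg
  set m : ℝ := morreyConst d q with hm
  have hm0 : 0 ≤ m := morreyConst_nonneg (by linarith) hdq
  have hB0 : (0 : ℝ) ≤ B := B.2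
  have hlB : 0 ≤ Real.log (2 * B + 1) := Real.log_nonneg (by linarith)
  -- This is the pointwise bound with `H` replaced by `m` times the `L^p` bound `A` for `J`; neither
  -- `A` nor `m` involves `T`.
  refine ⟨fun t => 4 * √(2 * B * t) + 4 * B * t * (Real.log (2 * B + 1) + m * A), ?_, ?_⟩
  · have hc : Continuous fun t : ℝ =>
        4 * √(2 * B * t) + 4 * B * t * (Real.log (2 * B + 1) + m * A) := by fun_prop
    have h0 := hc.tendsto 0
    simp only [mul_zero, Real.sqrt_zero, zero_mul, add_zero] at h0
    exact h0.mono_left nhdsWithin_le_nhds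
  intro T hT b Db hb hBb hK Φ hΦ M Δt hΔt hM N Q hQ P Δx hΔx hdiam hlt t ht
  set δ := max Δt Δx with hδ
  have hδ0 : 0 < δ := hΔt.trans_le (le_max_left _ _)
  have hbB := ae_spaceTime_norm_le hBb
  obtain ⟨U, hU, hUK, hlip⟩ := hb.exists_lipschitz_majorant hq1 hdq hp1 hbB hK
  obtain ⟨Ψ, hΨ, hΨΦ, hΨL⟩ := hΦ.exists_measurable hT
  set J : Torus d → ℝ≥0∞ := fun x => ∫⁻ s in Ioc 0 T, flowMaximal q U s (Ψ s x) with hJ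
  have hgm : Measurable fun z : Torus d × ℝ => flowMaximal q U z.2 (Ψ z.2 z.1) :=
    (measurable_flowMaximal hU).comp (measurable_snd.prodMk (hΨ.comp measurable_swap))
  have hJm : Measurable J := hgm.lintegral_prod_right'
  have hJp : ∫⁻ x, J x ^ p ≤ flowMaximalBound d p q L K :=
    lintegral_flowMaximal_rpow_le hT hq1 hqp hΨ hΨL hU hUK
  have hJfin : ∀ᵐ x, J x < ⊤ := by
    have h1 : ∀ᵐ x, J x ^ p < ⊤ := ae_lt_top (hJm.pow_const p)
      (ne_top_of_le_ne_top (flowMaximalBound_ne_top d hp0.le q L K) hJp)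
    filter_upwards [h1] with x hx
    exact (ENNReal.rpow_lt_top_iff_of_pos hp0).1 hx
  -- Cells of measure zero carry no meaningful average, but being finitely many they cover only a
  -- null set.
  have hcell : ∀ᵐ x, volume (Q (P.index x)) ≠ 0 := by
    have h1 : ∀ᵐ x, ∀ i, x ∈ Q i → volume (Q i) ≠ 0 := by
      refine ae_all_iff.2 fun i => ?_
      by_cases hi : volume (Q i) = 0
      · filter_upwards [measure_eq_zero_iff_ae_notMem.1 hi] with x hx hxi using absurd hxi hx
      · exact Eventually.of_forall fun x _ => hi
    filter_upwards [h1] with x hx using hx _ (P.mem_index x)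
  set l := |Real.log δ|⁻¹ with hl
  have hl0 : 0 ≤ l := inv_nonneg.2 (abs_nonneg _)
  have ht0 : 0 ≤ t := ht.1
  set a₀ : ℝ := 4 * √(2 * B * t) + 4 * B * t * Real.log (2 * B + 1) with ha₀
  set a₁ : ℝ := 4 * B * t * m with ha₁
  have ha₀0 : 0 ≤ a₀ := by positivity
  have ha₁0 : 0 ≤ a₁ := by positivity
  have hpt : ∀ᵐ x, ‖torusNorm (Φ t x - meanEulerFlow b Δt P t x)‖ₑ ≤
      ENNReal.ofReal (l * a₀) + ENNReal.ofReal (l * a₁) * J x := by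
    filter_upwards [hΦ.solution, hΨΦ, hJfin, hcell, ae_ae_flow_of_ae_spaceTime hΨ hΨL hbB,
      ae_ae_flow_of_ae_spaceTime hΨ hΨL hlip] with x h1 h2 h3 h4 h5 h6
    have heq : ∀ᵐ s ∂(volume.restrict (Ioc 0 T)), Ψ s x = Φ s x := by
      filter_upwards [ae_restrict_mem measurableSet_Ioc] with s hs
      exact h2 s (Ioc_subset_Icc_self hs)
    obtain ⟨V, hV0, hVlog, hV1, hV2⟩ := exists_trajectory_error_bound (x₀ := P.some (P.index x))
      (N := fun s => flowMaximal q U s (Ψ s x)) hT hΔt hM hδ0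
      (le_max_left _ _) (le_max_right _ _) hm0 hb.memLp_top.1 hbB h4 (hQ _)
      (hdiam _ x (P.mem_index x)) h1 (by
        filter_upwards [h5, heq] with s hs hse
        rw [← hse]; exact hs)
      (hgm.comp measurable_prodMk_left).aemeasurable h3.ne (by
        filter_upwards [h6, heq] with s hs hse
        rw [← hse]; exact hs) ht rfl
    have hfinal := le_inv_abs_log_mul (torusNorm_nonneg _) hV2 hV1 hV0 hB0 ht0 hδ0 hlt hVlog
    rw [Real.enorm_eq_ofReal (torusNorm_nonneg _)]
    calc _ ≤ ENNReal.ofReal (l * a₀ + l * a₁ * (J x).toReal) := by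
          refine ENNReal.ofReal_le_ofReal (hfinal.trans (le_of_eq ?_))
          simp only [ha₀, ha₁, hl, hJ]
          ring
      _ = _ := by
          rw [ENNReal.ofReal_add (by positivity) (by positivity),
            ENNReal.ofReal_mul (p := l * a₁) (by positivity), ENNReal.ofReal_toReal h3.ne]
  calc _ ≤ ENNReal.ofReal (l * a₀) + ENNReal.ofReal (l * a₁) * (∫⁻ x, J x ^ p) ^ (1 / p) :=
        eLpNorm_le_of_enorm_le_const_add_mul hp1.le hJm hpt
    _ ≤ ENNReal.ofReal (l * a₀) + ENNReal.ofReal (l * a₁) * ENNReal.ofReal A := by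
        rw [hA, ENNReal.ofReal_toReal hAtop]
        gcongr
    _ = _ := by
        rw [← ENNReal.ofReal_mul (by positivity), ← ENNReal.ofReal_add (by positivity)
          (by positivity)]
        congr 1
        simp only [ha₀, ha₁]
        ring
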